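/- Let $n\in\mathbb N=\{1,2,\dots\}$ and let $|\cdot|$ be the Euclidean norm on $\mathbb R^n$. Put $L_{-1}(t)=e^t$, $L_0(t)=t$, $L_{m+1}(t)=\ln L_m(t)$ for integers $m\ge 0$ (for $t$ so large that $L_m(t)>0$), and $\widehat{\mathcal L}_k(t)=(L_{-1}(t),L_0(t),\dots,L_k(t))$. For integers $k\ge m\ge 0$, let $\mathcal P^1_m(k,\mathbb R^n)$ be the set of all finite sums of functions $$(0,\infty)^{k+2}\ni z=(z_{-1},z_0,\dots,z_k)\mapsto \Big(\prod_{j=-1}^k z_j^{\alpha_j}\Big)\prod_{j=0}^k\sigma_j(\omega_jz_j)\,\xi,$$ where $\xi\in\mathbb R^n$, $\alpha_j,\omega_j\in\mathbb R$, $\alpha_{-1}=\alpha_0=\dots=\alpha_m=0$, and each $\sigma_j$ is either $\cos$ or $\sin$. Consider in $\mathbb R^n$ the system $$y'=-Ay+G(y)+f(t)\qquad(*)$$ under the following assumptions. (a) $A$ is a real $n\times n$ matrix all of whose complex eigenvalues have positive real parts. (b) $G:\mathbb R^n\to\mathbb R^n$ is locally Lipschitz, and there are functions $G_m:\mathbb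 R^n\to\mathbb R^n$, $m\ge 2$, each a homogeneous polynomial of degree $m$, such that for every $N\ge 2$ there is $\delta>0$ with $|G(x)-\sum_{m=2}^N G_m(x)|=\mathcal O(|x|^{N+\delta})$ as $x\to 0$. (c) $f$ is $\mathbb R^n$-valued and continuous on $[T_f,\infty)$ for some $T_f\ge 0$. (d) $y\in C^1((T_0,\infty),\mathbb R^n)$, for some $T_0\ge 0$, is a solution of $(*)$ on $(T_0,\infty)$, and $y(t)\to 0$ as $t\to\infty$. Let $m_*\ge 0$ be an integer, let $(\mu_k)_{k=1}^\infty$ be a strictly increasing sequence of positive numbers tending to $\infty$, and let $(n_k)_{k=1}^\infty$ be a nondecreasing sequence of integers with $n_k\ge m_*$ for all $k$. Assume that the set $\mathcal S=\{\mu_k:k\in\mathbb N\}$ is closed under addition and, if $m_*=0$, also under $x\mapsto x+1$. For a function $g$ defined for all large $t$ with values in $\mathbb R^n$, and $\widehat g_k\in\mathcal P^1_{m_*}(n_k,\mathbb R^n)$, write $g(t)\sim\sum_{k=1}^\infty \widehat g_k(\widehat{\mathcal L}_{n_k}(t))L_{m_*}(t)^{-\mu_k}$ if for every $N\in\mathbb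 N$ there is $\nu>\mu_N$ such that $$\Big|g(t)-\sum_{k=1}^N\widehat g_k(\widehat{\mathcal L}_{n_k}(t))L_{m_*}(t)^{-\mu_k}\Big|=\mathcal O(L_{m_*}(t)^{-\nu})\quad\text{as }t\to\infty.$$ **Theorem.** If $$f(t)\sim\sum_{k=1}^\infty\widehat p_k(\widehat{\mathcal L}_{n_k}(t))L_{m_*}(t)^{-\mu_k}\quad\text{with }\widehat p_k\in\mathcal P^1_{m_*}(n_k,\mathbb R^n)\text{ for all }k\in\mathbb N,$$ then there are $\widehat q_k\in\mathcal P^1_{m_*}(n_k,\mathbb R^n)$, $k\in\mathbb N$, such that $$y(t)\sim\sum_{k=1}^\infty\widehat q_k(\widehat{\mathcal L}_{n_k}(t))L_{m_*}(t)^{-\mu_k}.$$ -/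

import Mathlib

open Filter Topology Asymptotics

noncomputable section

namespace RealExpansion

/-- The space `ℝⁿ` with its Euclidean norm. -/
abbrev Vec (n : ℕ) : Type := EuclideanSpace ℝ (Fin n)

/-- The iterated logarithms `L_m`, `m ≥ 0`: `L_0(t) = t` and `L_{m+1}(t) = ln (L_m(t))`.
Only the values at large `t`, where every logarithm has a positive argument, are used. -/
def iterLog : ℕ → ℝ → ℝ
  | 0, t => t
  | m + 1, t => Real.log (iterLog m t)

/-- The vector `(L_{-1}(t), L_0(t), …, L_k(t))` with `L_{-1}(t) = exp t`. Vectors with the index set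
`{-1, 0, …, k}` are functions on `Fin (k + 2)`: the mathematical index `j` is the position `j + 1`.
In particular `z_{-1}` is `z 0`, and `z_j` is `z j.succ` for `j : Fin (k + 1)`. -/
def iterLogVec (k : ℕ) (t : ℝ) : Fin (k + 2) → ℝ :=
  Fin.cons (Real.exp t) (fun j : Fin (k + 1) => iterLog j t)

/-- The set `𝓔(m, k, μ)` of exponents `α = (α_{-1}, α_0, …, α_k) ∈ ℂ^{k+2}` with `Re α_j = 0` for
`-1 ≤ j < m` and `Re α_m = μ` (for integers `k ≥ m ≥ 0`). -/
def exponents (m k : ℕ) (μ : ℝ) : Set (Fin (k + 2) → ℂ) :=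
  {α | (∀ j : Fin (k + 2), (j : ℕ) < m + 1 → (α j).re = 0) ∧
    ∀ j : Fin (k + 2), (j : ℕ) = m + 1 → (α j).re = μ}

/-- The class `𝒫¹_m(k, ℝⁿ)`: finite sums of functions
`z ↦ z^α * ∏_{j=0}^k σ_j(ω_j z_j) • ξ` of `z = (z_{-1}, z_0, …, z_k) ∈ (0,∞)^{k+2}`, where `ξ ∈ ℝⁿ`,
`α` is a real vector in `𝓔(m, k, 0)`, the `ω_j` are real, and every `σ_j` is `cos` or `sin`.
The functions have the domain `(0,∞)^{k+2}`, so their values elsewhere are left free. -/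
def powTrigClass (m k n : ℕ) : Set ((Fin (k + 2) → ℝ) → Vec n) :=
  {p | ∃ (N : ℕ) (ξ : Fin N → Vec n) (α : Fin N → Fin (k + 2) → ℝ)
      (ω : Fin N → Fin (k + 1) → ℝ) (σ : Fin N → Fin (k + 1) → ℝ → ℝ),
    (∀ i, (fun j => (α i j : ℂ)) ∈ exponents m k 0) ∧
    (∀ i j, σ i j = Real.cos ∨ σ i j = Real.sin) ∧
    ∀ z : Fin (k + 2) → ℝ, (∀ j, 0 < z j) →
      p z = ∑ i, ((∏ j, z j ^ α i j) * ∏ j : Fin (k + 1), σ i j (ω i j * z j.succ)) • ξ i}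

/-- The asymptotic expansion `g(t) ∼ ∑_k ĝ_k(L_{-1}(t), …, L_{n_k}(t)) L_m(t)^{-γ_k}` of a function
defined for large `t`: for every `N` the partial sum through the `N`-th term has an error
`O(L_m(t)^{-ν})` as `t → ∞`, for some `ν > γ_N`. Sequences are indexed from `0`. -/
def HasExpansion {n : ℕ} (m : ℕ) (γ : ℕ → ℝ) (d : ℕ → ℕ) (g : ℝ → Vec n)
    (ghat : (k : ℕ) → (Fin (d k + 2) → ℝ) → Vec n) : Prop :=
  ∀ N : ℕ, ∃ ν : ℝ, γ N < ν ∧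
    (fun t : ℝ => g t - ∑ k ∈ Finset.range (N + 1),
        (iterLog m t ^ (-γ k)) • ghat k (iterLogVec (d k) t))
      =O[atTop] fun t : ℝ => iterLog m t ^ (-ν)

/-- `S` is closed under addition. -/
def PreservesAddition (S : Set ℝ) : Prop := ∀ x ∈ S, ∀ y ∈ S, x + y ∈ S

/-- `S` is closed under `x ↦ x + 1`. -/
def PreservesUnitIncrement (S : Set ℝ) : Prop := ∀ x ∈ S, x + 1 ∈ S

/-- All complex eigenvalues of the real matrix `A` have positive real parts. -/
def PositiveSpectrum {n : ℕ} (A : Matrix (Fin n) (Fin n) ℝ) : Prop :=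
  ∀ z : ℂ, Module.End.HasEigenvalue (Matrix.toLin' (A.map (fun a : ℝ => (a : ℂ)))) z → 0 < z.re

/-- `H : ℝⁿ → ℝⁿ` is a homogeneous polynomial of degree `m`: each of its components is. -/
def IsHomogeneousPolynomial {n : ℕ} (m : ℕ) (H : Vec n → Vec n) : Prop :=
  ∃ P : Fin n → MvPolynomial (Fin n) ℝ, (∀ i, (P i).IsHomogeneous m) ∧
    ∀ x i, H x i = MvPolynomial.eval (fun j => x j) (P i)

/-- `G` has the expansion `G(x) ∼ ∑_{m ≥ 2} G_m(x)` as `x → 0`, with homogeneous polynomials `G_m`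
of degree `m`. -/
def HasPolynomialExpansion {n : ℕ} (G : Vec n → Vec n) : Prop :=
  ∃ H : ℕ → Vec n → Vec n, (∀ m, 2 ≤ m → IsHomogeneousPolynomial m (H m)) ∧
    ∀ N : ℕ, 2 ≤ N → ∃ δ : ℝ, 0 < δ ∧
      (fun x => G x - ∑ m ∈ Finset.Icc 2 N, H m x) =O[𝓝 0] fun x => ‖x‖ ^ ((N : ℝ) + δ)

/-- `y` is a `C¹` solution of `y' = -A y + G(y) + f(t)` on `(T, ∞)`. -/
def IsSolution {n : ℕ} (A : Matrix (Fin n) (Fin n) ℝ) (G : Vec n → Vec n) (f : ℝ → Vec n)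
    (T : ℝ) (y : ℝ → Vec n) : Prop :=
  ContDiffOn ℝ 1 y (Set.Ioi T) ∧
    ∀ t, T < t → HasDerivAt y (-(Matrix.toEuclideanLin A (y t)) + G (y t) + f t) t

end RealExpansion

end

namespace IterLogExpansion

open RealExpansion

/-! The expansion is built formally, layer by layer, and the true solution is then compared with its
partial sums.

A coefficient at `L_m ^ (-μ N)` is a trigonometric polynomial in `t` times a function of `L_1, L_2,
…`. Differentiating the latter factor, or the power of `L_m`, always produces a factor `1/t`. For `m
= 0` this raises the exponent by one, and closure under `x ↦ x + 1` keeps it in the scale; for `m ≥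
1` it is smaller than every power of `L_m`. Within one layer the slow factor may therefore be
treated as constant, and `q' = -A q + h` is solved by an ansatz `a cos ωt + b sin ωt`. This never
resonates, since `A` has no purely imaginary eigenvalue (`exists_harmonic_response`,
`AdmissibleScale.mem_solvable`). Closure under addition makes products of layers land in strictly
later layers, so the nonlinearity at layer `N` sees only earlier terms and the recursion closes
(`exists_formalSolution`).

For the comparison, a Lyapunov form shows that `v' = -A v + o(v) + O(L_m ^ (-ν))` forces `v = O(L_m
^ (-ν))` (`exists_isBigO_of_stable`, `isBigO_logPow_of_stable`). Applied to `y`, this gives an a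
priori rate that controls the Taylor remainder of `G`; applied to `y` minus a partial sum, it gives
the expansion.

Spaces of functions of `t` are submodules under pointwise multiplication, so closure properties are
checked on generators. -/

/-! ### Growth and decay measured in powers of `L_m`. -/

/-- The power `L_m ^ a`, in the form `exp (a * L_{m+1})`, which is multiplicative everywhere. -/
noncomputable def logPow (m : ℕ) (a : ℝ) : ℝ → ℝ := fun t => Real.exp (a * iterLog (m + 1) t)

theorem tendsto_iterLog (j : ℕ) : Tendsto (iterLog j) atTop atTop := by
  induction j with
  | zero => exact tendsto_id
  | succ j ih => exact Real.tendsto_log_atTop.comp ih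

theorem logPow_pos (m : ℕ) (a : ℝ) (t : ℝ) : 0 < logPow m a t := Real.exp_pos _

theorem logPow_add (m : ℕ) (a b : ℝ) : logPow m (a + b) = logPow m a * logPow m b := by
  ext t; simp [logPow, add_mul, Real.exp_add]

theorem logPow_zero (m : ℕ) : logPow m 0 = 1 := by
  ext t; simp [logPow]

theorem iterLog_rpow_eventuallyEq (m : ℕ) (a : ℝ) :
    (fun t => iterLog m t ^ a) =ᶠ[atTop] logPow m a := by
  filter_upwards [(tendsto_iterLog m).eventually_gt_atTop 0] with t ht
  rw [Real.rpow_def_of_pos ht, logPow, iterLog, mul_comm]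

theorem iterLog_isLittleO {i j : ℕ} (h : i < j) : iterLog j =o[atTop] iterLog i := by
  induction j, h using Nat.le_induction with
  | base => exact Real.isLittleO_log_id_atTop.comp_tendsto (tendsto_iterLog i)
  | succ j _ ih =>
    exact (Real.isLittleO_log_id_atTop.comp_tendsto (tendsto_iterLog j)).trans ih

theorem mul_iterLog_eventually_le {i j : ℕ} (h : i < j) (a : ℝ) {ε : ℝ} (hε : 0 < ε) :
    ∀ᶠ t in atTop, a * iterLog j t ≤ ε * iterLog i t := by
  have h1 := ((iterLog_isLittleO h).const_mul_left a).bound hε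
  filter_upwards [h1, (tendsto_iterLog i).eventually_gt_atTop 0] with t ht h0
  rw [Real.norm_of_nonneg h0.le] at ht
  exact (le_abs_self _).trans ht

/-- The functions that are `O(L_m ^ (-ν))`. -/
def decay (m : ℕ) (ν : ℝ) : Submodule ℝ (ℝ → ℝ) where
  carrier := {g | g =O[atTop] logPow m (-ν)}
  add_mem' ha hb := IsBigO.add ha hb
  zero_mem' := isBigO_zero _ _
  smul_mem' c _ h := IsBigO.const_smul_left h c

theorem mem_decay {m : ℕ} {ν : ℝ} {g : ℝ → ℝ} :
    g ∈ decay m ν ↔ g =O[atTop] logPow m (-ν) := Iff.rfl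

theorem decay_mul (m : ℕ) (a b : ℝ) : decay m a * decay m b ≤ decay m (a + b) := by
  rw [Submodule.mul_le]
  intro x hx y hy
  rw [mem_decay, neg_add, logPow_add]
  exact IsBigO.mul hx hy

theorem isBigO_exp_of_eventually_le {u v : ℝ → ℝ} (h : ∀ᶠ t in atTop, u t ≤ v t) :
    (fun t => Real.exp (u t)) =O[atTop] fun t => Real.exp (v t) :=
  IsBigO.of_bound 1 (by
    filter_upwards [h] with t ht
    simpa using ht)

theorem logPow_isBigO {m : ℕ} {a b : ℝ} (h : a ≤ b) : logPow m a =O[atTop] logPow m b := by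
  refine isBigO_exp_of_eventually_le ?_
  filter_upwards [(tendsto_iterLog (m + 1)).eventually_ge_atTop 0] with t ht
  gcongr

theorem decay_antitone {m : ℕ} {a b : ℝ} (h : a ≤ b) : decay m b ≤ decay m a :=
  fun _ hx => IsBigO.trans hx (logPow_isBigO (neg_le_neg h))

/-- The functions smaller than every power of `L_m`. -/
noncomputable def negligible (m : ℕ) : Submodule ℝ (ℝ → ℝ) := ⨅ ν : ℝ, decay m ν

/-- The functions growing slower than every positive power of `L_m`. -/
noncomputable def subpoly (m : ℕ) : Submodule ℝ (ℝ → ℝ) := ⨅ ε : ℝ, ⨅ _ : 0 < ε, decay m (-ε)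

theorem mem_negligible {m : ℕ} {g : ℝ → ℝ} : g ∈ negligible m ↔ ∀ ν, g ∈ decay m ν := by
  simp [negligible]

theorem mem_subpoly {m : ℕ} {g : ℝ → ℝ} : g ∈ subpoly m ↔ ∀ ε, 0 < ε → g ∈ decay m (-ε) := by
  simp [subpoly]

theorem negligible_le_decay (m : ℕ) (ν : ℝ) : negligible m ≤ decay m ν := iInf_le _ _

theorem negligible_mul_decay (m : ℕ) (a : ℝ) : negligible m * decay m a ≤ negligible m := by
  refine le_iInf fun ν => ?_
  calc negligible m * decay m a ≤ decay m (ν - a) * decay m a :=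
        mul_le_mul_left (negligible_le_decay m _) _
    _ ≤ decay m (ν - a + a) := decay_mul _ _ _
    _ = decay m ν := by rw [sub_add_cancel]

theorem subpoly_le_decay {m : ℕ} {ε : ℝ} (h : 0 < ε) : subpoly m ≤ decay m (-ε) :=
  iInf₂_le ε h

theorem decay_zero_le_subpoly (m : ℕ) : decay m 0 ≤ subpoly m :=
  le_iInf₂ fun _ h => decay_antitone (neg_nonpos.2 h.le)

theorem negligible_mul_subpoly (m : ℕ) : negligible m * subpoly m ≤ negligible m :=
  (mul_le_mul_right (subpoly_le_decay one_pos) _).trans (negligible_mul_decay m _)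

theorem subpoly_mul_subpoly (m : ℕ) : subpoly m * subpoly m ≤ subpoly m := by
  refine le_iInf₂ fun ε hε => ?_
  calc subpoly m * subpoly m ≤ decay m (-(ε / 2)) * decay m (-(ε / 2)) :=
        mul_le_mul' (subpoly_le_decay (half_pos hε)) (subpoly_le_decay (half_pos hε))
    _ ≤ decay m (-(ε / 2) + -(ε / 2)) := decay_mul _ _ _
    _ = decay m (-ε) := by ring_nf

theorem mem_decay_zero_of_abs_le {m : ℕ} {g : ℝ → ℝ} {C : ℝ} (h : ∀ᶠ t in atTop, |g t| ≤ C) :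
    g ∈ decay m 0 := by
  rw [mem_decay, neg_zero, logPow_zero]
  exact IsBigO.of_bound C (by simpa using h)

theorem one_mem_subpoly (m : ℕ) : (1 : Submodule ℝ (ℝ → ℝ)) ≤ subpoly m := by
  rw [Submodule.one_le]
  exact decay_zero_le_subpoly m (mem_decay_zero_of_abs_le (C := 1) (by simp))

/-! ### Derivatives of iterated logarithms. -/

/-- The derivative of `L_j` near infinity, `1 / (L_0 ⋯ L_{j-1})`. -/
noncomputable def iterLogDeriv : ℕ → ℝ → ℝ
  | 0 => 1
  | j + 1 => iterLogDeriv j * logPow j (-1)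

theorem hasDerivAt_iterLog (j : ℕ) :
    ∀ᶠ t in atTop, HasDerivAt (iterLog j) (iterLogDeriv j t) t := by
  induction j with
  | zero => exact .of_forall fun t => hasDerivAt_id t
  | succ j ih =>
    filter_upwards [ih, (tendsto_iterLog j).eventually_gt_atTop 0] with t ht h0
    have := ht.log h0.ne'
    refine this.congr_deriv ?_
    simp [iterLogDeriv, logPow, iterLog, Real.exp_neg, Real.exp_log h0, div_eq_mul_inv]

theorem logPow_neg_one_mem_decay_zero (m j : ℕ) : logPow j (-1) ∈ decay m 0 := by
  refine mem_decay_zero_of_abs_le (C := 1) ?_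
  filter_upwards [(tendsto_iterLog (j + 1)).eventually_ge_atTop 0] with t ht
  rw [abs_of_pos (logPow_pos _ _ _)]
  simpa [logPow] using ht

theorem iterLogDeriv_succ_mem_negligible {m : ℕ} (hm : 0 < m) (j : ℕ) :
    iterLogDeriv (j + 1) ∈ negligible m := by
  induction j with
  | zero =>
    rw [mem_negligible]
    intro ν
    simp only [iterLogDeriv, one_mul, mem_decay]
    refine isBigO_exp_of_eventually_le ?_
    -- In exponential form the claim is `ν * L_{m+1} ≤ L_1` eventually, which holds because `m ≥ 1`.
    filter_upwards [mul_iterLog_eventually_le (i := 0 + 1) (j := m + 1) (by omega) ν one_pos]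
      with t ht
    linarith
  | succ j ih =>
    rw [iterLogDeriv]
    exact negligible_mul_decay m 0
      (Submodule.mul_mem_mul ih (logPow_neg_one_mem_decay_zero m _))

theorem tendsto_iterLogDeriv_succ (j : ℕ) : Tendsto (iterLogDeriv (j + 1)) atTop (𝓝 0) := by
  have key : iterLogDeriv (j + 1) =O[atTop] logPow 0 (-1) := by
    induction j with
    | zero => simpa [iterLogDeriv] using isBigO_refl _ _
    | succ j ih =>
      have h := logPow_neg_one_mem_decay_zero 0 (j + 1)
      rw [mem_decay, neg_zero, logPow_zero] at h
      have h2 := ih.mul h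
      simp only [Pi.one_apply, mul_one] at h2
      exact h2
  refine key.trans_tendsto ?_
  have : Tendsto (fun t => -iterLog 1 t) atTop atBot :=
    tendsto_neg_atTop_atBot.comp (tendsto_iterLog 1)
  exact (Real.tendsto_exp_atBot.comp this).congr fun t => by simp [logPow]

theorem hasDerivAt_logPow (m : ℕ) (a : ℝ) :
    ∀ᶠ t in atTop, HasDerivAt (logPow m a) (a * iterLogDeriv (m + 1) t * logPow m a t) t := by
  filter_upwards [hasDerivAt_iterLog (m + 1)] with t ht
  exact ((ht.const_mul a).exp).congr_deriv (by simp only [logPow]; ring)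

/-! ### The algebra of coefficients. -/

/-- The functions `L_j ^ a * σ (ω * L_j)` with `σ` either `cos` or `sin`, where `a = 0` unless
`j > m`. -/
def levelGen (m j : ℕ) : Set (ℝ → ℝ) :=
  {g | ∃ (a ω : ℝ) (σ : ℝ → ℝ), (j ≤ m → a = 0) ∧ (σ = Real.cos ∨ σ = Real.sin) ∧
    g = fun t => logPow j a t * σ (ω * iterLog j t)}

/-- The span of the functions of `L_j` that may occur in a coefficient. -/
noncomputable def level (m j : ℕ) : Submodule ℝ (ℝ → ℝ) := Submodule.span ℝ (levelGen m j)

theorem one_le_level (m j : ℕ) : 1 ≤ level m j := by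
  rw [Submodule.one_le]
  exact Submodule.subset_span ⟨0, 0, Real.cos, fun _ => rfl, .inl rfl, by ext t; simp [logPow]⟩

/-- The product-to-sum formulas keep a product of two trigonometric factors linear in such factors,
with frequencies `ω ± υ`. -/
theorem level_mul_level (m j : ℕ) : level m j * level m j ≤ level m j := by
  rw [level, Submodule.span_mul_span, Submodule.span_le]
  rintro _ ⟨_, ⟨a, ω, σ, ha, hσ, rfl⟩, _, ⟨b, υ, τ, hb, hτ, rfl⟩, rfl⟩
  have key : ∀ (c : ℝ) (θ : ℝ) (κ : ℝ → ℝ), (κ = Real.cos ∨ κ = Real.sin) →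
      (fun t => c * (logPow j (a + b) t * κ (θ * iterLog j t))) ∈ level m j := fun c θ κ hκ =>
    Submodule.smul_mem _ c (Submodule.subset_span
      ⟨a + b, θ, κ, fun h => by rw [ha h, hb h, add_zero], hκ, rfl⟩)
  have fin : ∀ (c d : ℝ) (κ : ℝ → ℝ), (κ = Real.cos ∨ κ = Real.sin) →
      (∀ x y, σ x * τ y = c * κ (x + y) + d * κ (x - y)) →
      ((fun t => logPow j a t * σ (ω * iterLog j t)) *
        fun t => logPow j b t * τ (υ * iterLog j t)) ∈ level m j := by
    intro c d κ hκ h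
    convert Submodule.add_mem _ (key c (ω + υ) κ hκ) (key d (ω - υ) κ hκ) using 1
    ext t
    simp only [Pi.mul_apply, Pi.add_apply, logPow_add, add_mul, sub_mul]
    linear_combination logPow j a t * logPow j b t * h (ω * iterLog j t) (υ * iterLog j t)
  rcases hσ with rfl | rfl <;> rcases hτ with rfl | rfl
  · exact fin (1 / 2) (1 / 2) _ (.inl rfl) fun x y => by rw [Real.cos_add, Real.cos_sub]; ring
  · exact fin (1 / 2) (-1 / 2) _ (.inr rfl) fun x y => by rw [Real.sin_add, Real.sin_sub]; ring
  · exact fin (1 / 2) (1 / 2) _ (.inr rfl) fun x y => by rw [Real.sin_add, Real.sin_sub]; ring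
  · exact fin (-1 / 2) (1 / 2) _ (.inl rfl) fun x y => by rw [Real.cos_add, Real.cos_sub]; ring

theorem abs_trig_le_one {σ : ℝ → ℝ} (hσ : σ = Real.cos ∨ σ = Real.sin) (x : ℝ) : |σ x| ≤ 1 := by
  rcases hσ with rfl | rfl
  · exact Real.abs_cos_le_one x
  · exact Real.abs_sin_le_one x

theorem level_le_subpoly (m j : ℕ) : level m j ≤ subpoly m := by
  rw [level, Submodule.span_le]
  rintro _ ⟨a, ω, σ, ha, hσ, rfl⟩
  refine subpoly_mul_subpoly m (Submodule.mul_mem_mul (m := logPow j a) ?_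
    (decay_zero_le_subpoly m (mem_decay_zero_of_abs_le (g := fun t => σ (ω * iterLog j t))
      (.of_forall fun t => abs_trig_le_one hσ _))))
  rcases le_or_gt j m with h | h
  · rw [ha h, logPow_zero]
    exact Submodule.one_le.1 (one_mem_subpoly m)
  · refine mem_subpoly.2 fun ε hε => ?_
    rw [mem_decay, neg_neg]
    exact isBigO_exp_of_eventually_le (mul_iterLog_eventually_le (by omega) a hε)

theorem prod_mem_of_mul_le {ι : Type*} {M : Submodule ℝ (ℝ → ℝ)} (h1 : 1 ≤ M) (h2 : M * M ≤ M)
    (s : Finset ι) (u : ι → Submodule ℝ (ℝ → ℝ)) (hu : ∀ i ∈ s, u i ≤ M) :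
    ∏ i ∈ s, u i ≤ M := by
  classical
  induction s using Finset.induction_on with
  | empty => simpa using h1
  | insert i s hi ih =>
    rw [Finset.prod_insert hi]
    exact (mul_le_mul' (hu i (Finset.mem_insert_self _ _))
      (ih fun j hj => hu j (Finset.mem_insert_of_mem hj))).trans h2

/-- The scalar functions `p (L_{-1}, L_0, …, L_k)` with `p` in the scalar analogue of
`powTrigClass m k`. -/
noncomputable def coeffs (m k : ℕ) : Submodule ℝ (ℝ → ℝ) := ∏ j ∈ Finset.range (k + 1), level m j

/-- The part of `coeffs m k` that does not depend on `L_0`. -/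
noncomputable def slowCoeffs (m k : ℕ) : Submodule ℝ (ℝ → ℝ) :=
  ∏ j ∈ Finset.range k, level m (j + 1)

theorem coeffs_eq (m k : ℕ) : coeffs m k = level m 0 * slowCoeffs m k := by
  rw [coeffs, slowCoeffs, Finset.prod_range_succ', mul_comm]

theorem one_le_coeffs (m k : ℕ) : 1 ≤ coeffs m k := Finset.one_le_prod' fun j _ => one_le_level m j

theorem coeffs_mul_coeffs (m k : ℕ) : coeffs m k * coeffs m k ≤ coeffs m k := by
  rw [coeffs, ← Finset.prod_mul_distrib]
  exact Finset.prod_le_prod' fun j _ => level_mul_level m j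

theorem coeffs_le_subpoly (m k : ℕ) : coeffs m k ≤ subpoly m :=
  prod_mem_of_mul_le (one_mem_subpoly m) (subpoly_mul_subpoly m) _ _ fun j _ => level_le_subpoly m j

theorem coeffs_mono (m : ℕ) : Monotone (coeffs m) := by
  refine monotone_nat_of_le_succ fun k => ?_
  rw [coeffs, coeffs, Finset.prod_range_succ _ (k + 1)]
  exact (mul_one _).ge.trans (mul_le_mul_right (one_le_level m (k + 1)) _)

theorem level_le_coeffs {m k j : ℕ} (h : j ≤ k) : level m j ≤ coeffs m k := by
  rw [coeffs, ← Finset.mul_prod_erase _ _ (Finset.mem_range.2 (Nat.lt_succ_of_le h))]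
  exact (mul_one _).ge.trans (mul_le_mul_right (Finset.one_le_prod' fun j _ => one_le_level m j) _)

/-! ### Slowly varying coefficients. -/

/-- The space containing the derivatives of slow coefficients. -/
noncomputable def slowDerivs (m k : ℕ) : Submodule ℝ (ℝ → ℝ) :=
  negligible m ⊔ if m = 0 then Submodule.span ℝ {logPow m (-1)} * coeffs m k else ⊥

theorem slowDerivs_mul_coeffs (m k : ℕ) : slowDerivs m k * coeffs m k ≤ slowDerivs m k := by
  rw [slowDerivs, Submodule.sup_mul]
  refine sup_le_sup ((mul_le_mul_right (coeffs_le_subpoly m k) _).trans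
    (negligible_mul_subpoly m)) ?_
  split_ifs
  · rw [mul_assoc]
    exact mul_le_mul_right (coeffs_mul_coeffs m k) _
  · simp

theorem logPow_mem_level {m j : ℕ} (h : m < j) (a : ℝ) : logPow j a ∈ level m j :=
  Submodule.subset_span ⟨a, 0, Real.cos, fun h' => absurd h' (by omega), .inl rfl, by ext t; simp⟩

/-- For `m = 0` the factors `1/L_1, …, 1/L_j` of the derivative are themselves coefficients, which
leaves one factor `1/t`. -/
theorem iterLogDeriv_succ_mem_slowDerivs (m : ℕ) {k j : ℕ} (h : j ≤ k) :
    iterLogDeriv (j + 1) ∈ slowDerivs m k := by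
  rcases Nat.eq_zero_or_pos m with rfl | hm
  · induction j with
    | zero =>
      refine Submodule.mem_sup_right ?_
      rw [if_pos rfl]
      have := Submodule.mul_mem_mul (Submodule.mem_span_singleton_self (R := ℝ) (logPow 0 (-1)))
        (Submodule.one_le.1 (one_le_coeffs 0 k))
      simpa [iterLogDeriv] using this
    | succ j ih =>
      rw [iterLogDeriv]
      exact slowDerivs_mul_coeffs 0 k (Submodule.mul_mem_mul (ih (by omega))
        (level_le_coeffs h (logPow_mem_level (by omega) _)))
  · exact Submodule.mem_sup_left (iterLogDeriv_succ_mem_negligible hm j)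

/-- The elements of `coeffs m k` that are eventually differentiable with a derivative in
`slowDerivs m k`. -/
noncomputable def slowlyVarying (m k : ℕ) : Submodule ℝ (ℝ → ℝ) where
  carrier := {x | x ∈ coeffs m k ∧
    ∃ y ∈ slowDerivs m k, ∀ᶠ t in atTop, HasDerivAt x (y t) t}
  zero_mem' := ⟨zero_mem _, 0, zero_mem _, .of_forall fun t => hasDerivAt_const t 0⟩
  add_mem' := by
    rintro a b ⟨ha, a', ha', hda⟩ ⟨hb, b', hb', hdb⟩
    refine ⟨add_mem ha hb, a' + b', add_mem ha' hb', ?_⟩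
    filter_upwards [hda, hdb] with t h1 h2 using h1.add h2
  smul_mem' := by
    rintro c a ⟨ha, a', ha', hda⟩
    refine ⟨Submodule.smul_mem _ c ha, c • a', Submodule.smul_mem _ c ha', ?_⟩
    filter_upwards [hda] with t h1 using h1.const_smul c

theorem one_le_slowlyVarying (m k : ℕ) : 1 ≤ slowlyVarying m k := by
  rw [Submodule.one_le]
  exact ⟨Submodule.one_le.1 (one_le_coeffs m k), 0, zero_mem _,
    .of_forall fun t => hasDerivAt_const t 1⟩

theorem slowlyVarying_mul (m k : ℕ) :
    slowlyVarying m k * slowlyVarying m k ≤ slowlyVarying m k := by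
  rw [Submodule.mul_le]
  rintro a ⟨ha, a', ha', hda⟩ b ⟨hb, b', hb', hdb⟩
  refine ⟨coeffs_mul_coeffs m k (Submodule.mul_mem_mul ha hb), a' * b + b' * a,
    add_mem (slowDerivs_mul_coeffs m k (Submodule.mul_mem_mul ha' hb))
      (slowDerivs_mul_coeffs m k (Submodule.mul_mem_mul hb' ha)), ?_⟩
  filter_upwards [hda, hdb] with t h1 h2
  exact (h1.mul h2).congr_deriv (by simp [mul_comm])

/-- By the Leibniz rule the slowly varying functions are closed under products, so a single
generator at a level `j + 1 ≥ 1` suffices. Level `0` is excluded because `cos (ω t)` has a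
derivative of its own size. -/
theorem slowCoeffs_le_slowlyVarying {m k : ℕ} : slowCoeffs m k ≤ slowlyVarying m k := by
  refine prod_mem_of_mul_le (one_le_slowlyVarying m k) (slowlyVarying_mul m k) _ _ fun j hj => ?_
  have hj : j + 1 ≤ k := Finset.mem_range.1 hj
  rw [level, Submodule.span_le]
  rintro _ ⟨a, ω, σ, ha, hσ, rfl⟩
  have hcos : ∀ (κ : ℝ → ℝ), (κ = Real.cos ∨ κ = Real.sin) →
      (fun t => logPow (j + 1) a t * κ (ω * iterLog (j + 1) t)) ∈ coeffs m k := fun κ hκ =>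
    level_le_coeffs hj (Submodule.subset_span ⟨a, ω, κ, ha, hκ, rfl⟩)
  obtain ⟨τ, c, hτ, hd⟩ : ∃ (τ : ℝ → ℝ) (c : ℝ), (τ = Real.cos ∨ τ = Real.sin) ∧
      ∀ x, HasDerivAt σ (c * τ x) x := by
    rcases hσ with rfl | rfl
    · exact ⟨Real.sin, -1, .inr rfl, fun x => by simpa using Real.hasDerivAt_cos x⟩
    · exact ⟨Real.cos, 1, .inl rfl, fun x => by simpa using Real.hasDerivAt_sin x⟩
  have hpow : ∃ y ∈ slowDerivs m k, ∀ᶠ t in atTop, HasDerivAt (fun t => logPow (j + 1) a t)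
      (y t * logPow (j + 1) a t) t := by
    rcases le_or_gt (j + 1) m with h | h
    · refine ⟨0, zero_mem _, .of_forall fun t => ?_⟩
      rw [ha h, logPow_zero]
      simpa using hasDerivAt_const t (1 : ℝ)
    · refine ⟨a • (iterLogDeriv (j + 1) * logPow (j + 1) (-1)), Submodule.smul_mem _ _
        (slowDerivs_mul_coeffs m k (Submodule.mul_mem_mul
          (iterLogDeriv_succ_mem_slowDerivs m (by omega))
          (level_le_coeffs hj (logPow_mem_level h _)))), ?_⟩
      filter_upwards [hasDerivAt_logPow (j + 1) a] with t ht
      exact ht.congr_deriv (by simp [iterLogDeriv])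
  obtain ⟨y, hy, hyd⟩ := hpow
  refine ⟨hcos σ hσ, y * (fun t => logPow (j + 1) a t * σ (ω * iterLog (j + 1) t)) +
    (c * ω) • (iterLogDeriv (j + 1) * fun t => logPow (j + 1) a t * τ (ω * iterLog (j + 1) t)),
    add_mem (slowDerivs_mul_coeffs m k (Submodule.mul_mem_mul hy (hcos σ hσ)))
      (Submodule.smul_mem _ _ (slowDerivs_mul_coeffs m k (Submodule.mul_mem_mul
        (iterLogDeriv_succ_mem_slowDerivs m (by omega)) (hcos τ hτ)))), ?_⟩
  filter_upwards [hyd, hasDerivAt_iterLog (j + 1)] with t h1 h2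
  exact (h1.mul ((hd _).comp t (h2.const_mul ω))).congr_deriv (by simp; ring)

/-! ### The graded scale of layers and tails. -/

/-- The conditions on the exponents `μ k` and the lengths `d k` of an expansion in powers
of `L_m`. -/
structure AdmissibleScale (m : ℕ) (μ : ℕ → ℝ) (d : ℕ → ℕ) : Prop where
  pos : ∀ k, 0 < μ k
  strictMono : StrictMono μ
  monotone : Monotone d
  le : ∀ k, m ≤ d k
  add : PreservesAddition (Set.range μ)
  unit : m = 0 → PreservesUnitIncrement (Set.range μ)

/-- The scalar terms `p (L_{-1}, …, L_{d k}) * L_m ^ (-μ k)`. -/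
noncomputable def layer (m : ℕ) (μ : ℕ → ℝ) (d : ℕ → ℕ) (k : ℕ) : Submodule ℝ (ℝ → ℝ) :=
  Submodule.span ℝ {logPow m (-μ k)} * coeffs m (d k)

/-- Finite sums of terms of index at least `N`, up to negligible functions. -/
noncomputable def tail (m : ℕ) (μ : ℕ → ℝ) (d : ℕ → ℕ) (N : ℕ) : Submodule ℝ (ℝ → ℝ) :=
  negligible m ⊔ ⨆ k, layer m μ d (N + k)

variable {m : ℕ} {μ : ℕ → ℝ} {d : ℕ → ℕ}

theorem negligible_le_tail (N : ℕ) : negligible m ≤ tail m μ d N := le_sup_left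

theorem layer_le_tail {N k : ℕ} (h : N ≤ k) : layer m μ d k ≤ tail m μ d N := by
  obtain ⟨l, rfl⟩ := Nat.exists_eq_add_of_le h
  exact (le_iSup (fun l => layer m μ d (N + l)) l).trans le_sup_right

theorem tail_antitone {N N' : ℕ} (h : N ≤ N') : tail m μ d N' ≤ tail m μ d N :=
  sup_le (negligible_le_tail N) (iSup_le fun _ => layer_le_tail (by omega))

theorem tail_eq (N : ℕ) : tail m μ d N = layer m μ d N ⊔ tail m μ d (N + 1) := by
  refine le_antisymm (sup_le ((negligible_le_tail _).trans le_sup_right) (iSup_le fun k => ?_))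
    (sup_le (layer_le_tail le_rfl) (tail_antitone (Nat.le_succ N)))
  rcases k with _ | k
  · exact le_sup_left
  · exact (layer_le_tail (by omega)).trans le_sup_right

/-- The inequality is strict because coefficients may grow like any power of `L_{m+1}`; the gap `μ k
- ν` absorbs this growth. -/
theorem layer_le_decay {k : ℕ} {ν : ℝ} (h : ν < μ k) : layer m μ d k ≤ decay m ν := by
  calc layer m μ d k ≤ decay m (μ k) * decay m (-(μ k - ν)) :=
        mul_le_mul' (by
          rw [Submodule.span_le, Set.singleton_subset_iff]
          exact isBigO_refl _ _)
          ((coeffs_le_subpoly m _).trans (subpoly_le_decay (sub_pos.2 h)))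
    _ ≤ decay m (μ k + -(μ k - ν)) := decay_mul _ _ _
    _ = decay m ν := by ring_nf

theorem layer_mul_coeffs (k : ℕ) :
    layer m μ d k * coeffs m (d k) ≤ layer m μ d k := by
  rw [layer, mul_assoc]
  exact mul_le_mul_right (coeffs_mul_coeffs m _) _

theorem level_zero_mul_tail (N : ℕ) : level m 0 * tail m μ d N ≤ tail m μ d N := by
  rw [tail, mul_comm, Submodule.sup_mul, Submodule.iSup_mul]
  refine sup_le_sup ((mul_le_mul_right (level_le_subpoly m 0) _).trans
    (negligible_mul_subpoly m)) (iSup_mono fun k => ?_)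
  exact (mul_le_mul_right (level_le_coeffs (Nat.zero_le _)) _).trans (layer_mul_coeffs _)

namespace AdmissibleScale

variable (hS : AdmissibleScale m μ d)
include hS

theorem tail_le_decay {N : ℕ} {ν : ℝ} (h : ν < μ N) : tail m μ d N ≤ decay m ν :=
  sup_le (negligible_le_decay m ν) (iSup_le fun k =>
    layer_le_decay (h.trans_le (hS.strictMono.monotone (Nat.le_add_right N k))))

theorem layer_mul_layer (a b : ℕ) :
    ∃ c, b < c ∧ layer m μ d a * layer m μ d b ≤ layer m μ d c := by
  obtain ⟨c, hc⟩ := hS.add (μ a) ⟨a, rfl⟩ (μ b) ⟨b, rfl⟩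
  have hac : a < c := hS.strictMono.lt_iff_lt.1 (by linarith [hS.pos b])
  have hbc : b < c := hS.strictMono.lt_iff_lt.1 (by linarith [hS.pos a])
  refine ⟨c, hbc, ?_⟩
  rw [layer, layer, mul_mul_mul_comm, Submodule.span_mul_span, Set.singleton_mul_singleton,
    ← logPow_add, ← neg_add, ← hc, layer]
  exact mul_le_mul_right ((mul_le_mul' (coeffs_mono m (hS.monotone hac.le))
    (coeffs_mono m (hS.monotone hbc.le))).trans (coeffs_mul_coeffs m _)) _

/-- The positive exponents add inside the scale, so multiplying by any decaying term raises the
index. This strict gain makes the nonlinearity triangular. -/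
theorem tail_mul_tail (N : ℕ) : tail m μ d 0 * tail m μ d N ≤ tail m μ d (N + 1) := by
  have hdec : ∀ k, tail m μ d k ≤ decay m 0 := fun k => hS.tail_le_decay (hS.pos k)
  have hneg : negligible m * decay m 0 ≤ tail m μ d (N + 1) :=
    (negligible_mul_decay m 0).trans (negligible_le_tail _)
  have hlayer : ∀ k, layer m μ d k ≤ decay m 0 := fun k => layer_le_decay (hS.pos k)
  rw [tail, Submodule.sup_mul]
  refine sup_le ((mul_le_mul_right (hdec N) _).trans hneg) ?_
  rw [Submodule.iSup_mul]
  refine iSup_le fun k => ?_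
  rw [tail, Submodule.mul_sup, Submodule.mul_iSup]
  refine sup_le ?_ (iSup_le fun l => ?_)
  · rw [mul_comm]
    exact (mul_le_mul_right (hlayer _) _).trans hneg
  · obtain ⟨c, hc, h⟩ := hS.layer_mul_layer (0 + k) (N + l)
    exact h.trans (layer_le_tail (by omega))

theorem mul_mem_tail_succ {N : ℕ} {x y : ℝ → ℝ} (hx : x ∈ tail m μ d 0) (hy : y ∈ tail m μ d N) :
    x * y ∈ tail m μ d (N + 1) :=
  hS.tail_mul_tail N (Submodule.mul_mem_mul hx hy)

theorem span_logPow_mul_slowDerivs (N : ℕ) :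
    Submodule.span ℝ {logPow m (-μ N)} * slowDerivs m (d N) ≤ tail m μ d (N + 1) := by
  rw [slowDerivs, Submodule.mul_sup]
  refine sup_le ?_ ?_
  · rw [mul_comm]
    refine (mul_le_mul_right (?_ : _ ≤ decay m (μ N)) _).trans
      ((negligible_mul_decay m _).trans (negligible_le_tail _))
    rw [Submodule.span_le, Set.singleton_subset_iff]
    exact isBigO_refl _ _
  · split_ifs with hm
    -- Here `t ^ (-μ N) * t ^ (-1) = t ^ (-μ c)` for an index `c > N`.
    · obtain ⟨c, hc⟩ := hS.unit hm (μ N) ⟨N, rfl⟩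
      have hNc : N < c := hS.strictMono.lt_iff_lt.1 (by linarith)
      rw [← mul_assoc, Submodule.span_mul_span, Set.singleton_mul_singleton, ← logPow_add,
        ← neg_add, ← hc]
      exact (mul_le_mul_right (coeffs_mono m (hS.monotone hNc.le)) _).trans (layer_le_tail hNc)
    · simp

theorem exists_deriv_mem_tail {N : ℕ} {x : ℝ → ℝ}
    (hx : x ∈ Submodule.span ℝ {logPow m (-μ N)} * slowCoeffs m (d N)) :
    ∃ y ∈ tail m μ d (N + 1), ∀ᶠ t in atTop, HasDerivAt x (y t) t := by
  obtain ⟨s, hs, rfl⟩ := Submodule.mem_span_singleton_mul.1 hx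
  obtain ⟨hsc, y, hy, hd⟩ := slowCoeffs_le_slowlyVarying hs
  refine ⟨logPow m (-μ N) * ((-μ N) • (iterLogDeriv (m + 1) * s) + y),
    hS.span_logPow_mul_slowDerivs N (Submodule.mul_mem_mul (Submodule.mem_span_singleton_self _)
      (add_mem (Submodule.smul_mem _ _ (slowDerivs_mul_coeffs m _ (Submodule.mul_mem_mul
        (iterLogDeriv_succ_mem_slowDerivs m (hS.le N)) hsc))) hy)), ?_⟩
  filter_upwards [hasDerivAt_logPow m (-μ N), hd] with t h1 h2
  exact (h1.mul h2).congr_deriv (by simp; ring)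

end AdmissibleScale

/-! ### The linear equation with oscillating forcing. -/

theorem isUnit_sub_of_re_nonpos {n : ℕ} {A : Matrix (Fin n) (Fin n) ℝ} (hA : PositiveSpectrum A)
    {z : ℂ} (hz : z.re ≤ 0) :
    IsUnit (algebraMap ℂ (Matrix (Fin n) (Fin n) ℂ) z - A.map (fun a : ℝ => (a : ℂ))) := by
  by_contra h
  have h1 : z ∈ spectrum ℂ (A.map (fun a : ℝ => (a : ℂ))) := h
  rw [← Matrix.spectrum_toLin', ← Module.End.hasEigenvalue_iff_mem_spectrum] at h1
  exact (hA z h1).not_ge hz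

/-- Over `ℂ` the matrix factors as `(iω - A)(-iω - A)`, and neither `±iω` is an eigenvalue.
Invertibility descends to `ℝ` through the determinant. -/
theorem isUnit_sq_add {n : ℕ} {A : Matrix (Fin n) (Fin n) ℝ} (hA : PositiveSpectrum A) (ω : ℝ) :
    IsUnit (A * A + (ω ^ 2) • (1 : Matrix (Fin n) (Fin n) ℝ)) := by
  have h := (isUnit_sub_of_re_nonpos hA (z := Complex.I * ω) (by simp)).mul
    (isUnit_sub_of_re_nonpos hA (z := -(Complex.I * ω)) (by simp))
  have e : (A * A + (ω ^ 2) • (1 : Matrix (Fin n) (Fin n) ℝ)).map (Complex.ofRealHom) =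
      (algebraMap ℂ (Matrix (Fin n) (Fin n) ℂ) (Complex.I * ω) - A.map (fun a : ℝ => (a : ℂ))) *
      (algebraMap ℂ (Matrix (Fin n) (Fin n) ℂ) (-(Complex.I * ω)) -
        A.map (fun a : ℝ => (a : ℂ))) := by
    have e1 : A.map (fun a : ℝ => (a : ℂ)) = A.map Complex.ofRealHom := rfl
    have e2 : Complex.I * (ω : ℂ) * (Complex.I * ω) = -((ω : ℂ) ^ 2) := by
      linear_combination (ω : ℂ) ^ 2 * Complex.I_mul_I
    have e3 : ((ω ^ 2) • (1 : Matrix (Fin n) (Fin n) ℝ)).map Complex.ofRealHom =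
        algebraMap ℂ (Matrix (Fin n) (Fin n) ℂ) ((ω : ℂ) ^ 2) := by
      ext i j
      by_cases hij : i = j <;> simp [Matrix.algebraMap_matrix_apply, hij]
    have e4 := Algebra.commutes (Complex.I * (ω : ℂ)) (A.map Complex.ofRealHom)
    have e5 := map_mul (algebraMap ℂ (Matrix (Fin n) (Fin n) ℂ)) (Complex.I * ω) (Complex.I * ω)
    rw [e2, map_neg] at e5
    rw [Matrix.map_add _ (by simp), e3, map_neg, e1, Matrix.map_mul]
    linear_combination (norm := noncomm_ring) -e5 + e4
  rw [← e, Matrix.isUnit_iff_isUnit_det, ← RingHom.mapMatrix_apply, ← RingHom.map_det,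
    isUnit_iff_ne_zero] at h
  rw [Matrix.isUnit_iff_isUnit_det, isUnit_iff_ne_zero]
  exact fun h0 => h (by rw [h0, map_zero])

-- These are the conditions for `a cos ωt + b sin ωt` to solve `q' = -A q + ξ cos ωt + η sin ωt`.
-- Eliminating `b` gives `(A² + ω²) a = A ξ - ω η`.
open Matrix in
theorem exists_harmonic_response {n : ℕ} {A : Matrix (Fin n) (Fin n) ℝ} (hA : PositiveSpectrum A)
    (ω : ℝ) (ξ η : Fin n → ℝ) :
    ∃ a b : Fin n → ℝ, A *ᵥ a + ω • b = ξ ∧ A *ᵥ b - ω • a = η := by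
  obtain ⟨M, hM⟩ := (isUnit_sq_add hA ω).exists_right_inv
  have key : ∀ v : Fin n → ℝ, A *ᵥ (A *ᵥ (M *ᵥ v)) + (ω ^ 2) • (M *ᵥ v) = v := fun v => by
    have := congrArg (fun B : Matrix (Fin n) (Fin n) ℝ => B *ᵥ v) hM
    simpa [add_mul, add_mulVec, mulVec_mulVec, smul_mulVec, mul_assoc] using this
  refine ⟨A *ᵥ (M *ᵥ ξ) - ω • (M *ᵥ η), ω • (M *ᵥ ξ) + A *ᵥ (M *ᵥ η), ?_, ?_⟩
  · conv_rhs => rw [← key ξ]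
    rw [mulVec_sub, mulVec_smul]
    module
  · conv_rhs => rw [← key η]
    rw [mulVec_add, mulVec_smul]
    module

/-- The equation `q' = -A q + h` near infinity, for a system given by its components. -/
def EventuallySolves {n : ℕ} (A : Matrix (Fin n) (Fin n) ℝ) (q h : Fin n → ℝ → ℝ) : Prop :=
  ∀ i, ∀ᶠ t in atTop, HasDerivAt (q i) (-(∑ j, A i j * q j t) + h i t) t

theorem EventuallySolves.add {n : ℕ} {A : Matrix (Fin n) (Fin n) ℝ} {q q' h h' : Fin n → ℝ → ℝ}
    (H : EventuallySolves A q h) (H' : EventuallySolves A q' h') :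
    EventuallySolves A (q + q') (h + h') := by
  intro i
  filter_upwards [H i, H' i] with t h1 h2
  refine (h1.add h2).congr_deriv ?_
  simp only [Pi.add_apply, mul_add, Finset.sum_add_distrib]
  ring

theorem EventuallySolves.smul {n : ℕ} {A : Matrix (Fin n) (Fin n) ℝ} {q h : Fin n → ℝ → ℝ}
    (c : ℝ) (H : EventuallySolves A q h) : EventuallySolves A (c • q) (c • h) := by
  intro i
  filter_upwards [H i] with t h1
  refine (h1.const_smul c).congr_deriv ?_
  simp only [Pi.smul_apply, smul_eq_mul, mul_left_comm _ c, ← Finset.mul_sum]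
  ring

/-- The forcing terms `h` for which `q' = -A q + h` has a solution in the `N`-th layer up to terms
of higher index. -/
noncomputable def solvable (m : ℕ) (μ : ℕ → ℝ) (d : ℕ → ℕ) {n : ℕ} (A : Matrix (Fin n) (Fin n) ℝ)
    (N : ℕ) : Submodule ℝ (Fin n → ℝ → ℝ) where
  carrier := {h | ∃ q r : Fin n → ℝ → ℝ, (∀ i, q i ∈ layer m μ d N) ∧
    (∀ i, r i ∈ tail m μ d (N + 1)) ∧ EventuallySolves A q (h + r)}
  zero_mem' := by
    refine ⟨0, 0, fun i => zero_mem _, fun i => zero_mem _, fun i => .of_forall fun t => ?_⟩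
    simp
  add_mem' := by
    rintro h h' ⟨q, r, hq, hr, H⟩ ⟨q', r', hq', hr', H'⟩
    refine ⟨q + q', r + r', fun i => add_mem (hq i) (hq' i), fun i => add_mem (hr i) (hr' i), ?_⟩
    rw [add_add_add_comm]
    exact H.add H'
  smul_mem' := by
    rintro c h ⟨q, r, hq, hr, H⟩
    refine ⟨c • q, c • r, fun i => Submodule.smul_mem _ c (hq i),
      fun i => Submodule.smul_mem _ c (hr i), ?_⟩
    rw [← smul_add]
    exact H.smul c

theorem trig_mem_level_zero (m : ℕ) (ω : ℝ) {σ : ℝ → ℝ} (hσ : σ = Real.cos ∨ σ = Real.sin) :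
    (fun t => σ (ω * t)) ∈ level m 0 :=
  Submodule.subset_span ⟨0, ω, σ, fun _ => rfl, hσ, by simp [logPow_zero, iterLog]⟩

theorem layer_eq (k : ℕ) : layer m μ d k =
    level m 0 * (Submodule.span ℝ {logPow m (-μ k)} * slowCoeffs m (d k)) := by
  rw [layer, coeffs_eq, mul_left_comm]

open Matrix in
theorem AdmissibleScale.smul_mem_solvable (hS : AdmissibleScale m μ d) {n : ℕ}
    {A : Matrix (Fin n) (Fin n) ℝ} (hA : PositiveSpectrum A) {N : ℕ} {x : ℝ → ℝ}
    (hx : x ∈ layer m μ d N) (ξ : Fin n → ℝ) :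
    (fun i => ξ i • x) ∈ solvable m μ d A N := by
  rw [layer_eq] at hx
  refine Submodule.mul_induction_on hx (fun x hx y hy => ?_) fun x y hx hy => ?_
  · obtain ⟨y', hy', hyd⟩ := hS.exists_deriv_mem_tail hy
    induction hx using Submodule.span_induction with
    | zero => convert zero_mem (solvable m μ d A N) using 1; ext i t; simp
    | add u v _ _ hu hv => convert add_mem hu hv using 1; ext i t; simp; ring
    | smul c u _ hu =>
      convert Submodule.smul_mem _ c hu using 1; ext i t; simp; ring
    | mem x hx =>
      obtain ⟨a₀, ω, σ, ha₀, hσ, rfl⟩ := hx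
      rw [ha₀ (Nat.zero_le m)]
      obtain ⟨c, e, hce⟩ : ∃ c e : ℝ, ∀ x, σ x = c * Real.cos x + e * Real.sin x := by
        rcases hσ with rfl | rfl
        · exact ⟨1, 0, by simp⟩
        · exact ⟨0, 1, by simp⟩
      obtain ⟨a, b, hab, hba⟩ := exists_harmonic_response hA ω (c • ξ) (e • ξ)
      have hmem : ∀ i, (a i • (fun t => Real.cos (ω * t)) + b i • fun t => Real.sin (ω * t)) ∈
          level m 0 := fun i =>
        add_mem (Submodule.smul_mem _ _ (trig_mem_level_zero m ω (.inl rfl)))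
          (Submodule.smul_mem _ _ (trig_mem_level_zero m ω (.inr rfl)))
      -- The harmonic response to the fast factor, with `y` treated as constant; the neglected
      -- product with `y'` lies in the next tail and becomes the remainder.
      refine ⟨fun i => (a i • (fun t => Real.cos (ω * t)) + b i • fun t => Real.sin (ω * t)) * y,
        fun i => (a i • (fun t => Real.cos (ω * t)) + b i • fun t => Real.sin (ω * t)) * y',
        fun i => ?_, fun i => level_zero_mul_tail _ (Submodule.mul_mem_mul (hmem i) hy'),
        fun i => ?_⟩
      · rw [layer_eq]
        exact Submodule.mul_mem_mul (hmem i) hy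
      · filter_upwards [hyd] with t ht
        have hlin : HasDerivAt (fun t : ℝ => ω * t) ω t := by
          simpa using (hasDerivAt_id t).const_mul ω
        have h1 := ((hlin.cos.const_smul (a i)).add (hlin.sin.const_smul (b i))).mul ht
        refine h1.congr_deriv ?_
        have ea := congrFun hab i
        have eb := congrFun hba i
        simp only [Pi.add_apply, Pi.sub_apply, Pi.smul_apply, smul_eq_mul, mulVec,
          dotProduct] at ea eb
        have es : ∑ j, A i j * ((a j * Real.cos (ω * t) + b j * Real.sin (ω * t)) * y t) =
            (∑ j, A i j * a j) * (Real.cos (ω * t) * y t) +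
              (∑ j, A i j * b j) * (Real.sin (ω * t) * y t) := by
          rw [Finset.sum_mul, Finset.sum_mul, ← Finset.sum_add_distrib]
          exact Finset.sum_congr rfl fun j _ => by ring
        simp only [Pi.add_apply, Pi.smul_apply, Pi.mul_apply, smul_eq_mul, es, hce, logPow_zero,
          Pi.one_apply, iterLog]
        linear_combination (Real.cos (ω * t) * y t) * ea + (Real.sin (ω * t) * y t) * eb
  · convert add_mem hx hy using 1
    ext i t; simp [mul_add]

theorem AdmissibleScale.mem_solvable (hS : AdmissibleScale m μ d) {n : ℕ}
    {A : Matrix (Fin n) (Fin n) ℝ} (hA : PositiveSpectrum A) {N : ℕ} {h : Fin n → ℝ → ℝ}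
    (hh : ∀ i, h i ∈ layer m μ d N) : h ∈ solvable m μ d A N := by
  have := Submodule.sum_mem (solvable m μ d A N) (t := Finset.univ)
    (f := fun i j => (Pi.single i (1 : ℝ) : Fin n → ℝ) j • h i)
    fun i _ => hS.smul_mem_solvable hA (hh i) (Pi.single i 1)
  convert this using 1
  ext j t
  have hite : ∀ c, (if j = c then h c else 0) t = if j = c then h c t else 0 := fun c => by
    split_ifs <;> rfl
  simp [Finset.sum_apply, Pi.single_apply, hite]

/-! ### Substitution into homogeneous polynomials. -/

/-- An induction principle: forms of degree `k` are spanned by products of `k` variables, so only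
variables and multiplication by linear forms need checking. -/
theorem homogeneousSubmodule_le_of_mul_le {ι : Type*}
    (C : ℕ → Submodule ℝ (MvPolynomial ι ℝ)) (hX : ∀ i, MvPolynomial.X i ∈ C 1)
    (hC : ∀ k, 1 ≤ k → C k * C 1 ≤ C (k + 1)) {k : ℕ} (hk : 1 ≤ k) :
    MvPolynomial.homogeneousSubmodule ι ℝ k ≤ C k := by
  have h1 : MvPolynomial.homogeneousSubmodule ι ℝ 1 ≤ C 1 := by
    rw [MvPolynomial.homogeneousSubmodule_one_eq_span_X, Submodule.span_le]
    rintro _ ⟨i, rfl⟩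
    exact hX i
  induction k, hk using Nat.le_induction with
  | base => exact h1
  | succ k hk ih =>
    rw [← MvPolynomial.homogeneousSubmodule_one_pow, pow_succ,
      MvPolynomial.homogeneousSubmodule_one_pow]
    exact (mul_le_mul' ih h1).trans (hC k hk)

theorem AdmissibleScale.aeval_mem_tail (hS : AdmissibleScale m μ d) {ι : Type*}
    {Y : ι → ℝ → ℝ} (hY : ∀ i, Y i ∈ tail m μ d 0) {k : ℕ} {P : MvPolynomial ι ℝ}
    (hP : P.IsHomogeneous (k + 1)) : MvPolynomial.aeval Y P ∈ tail m μ d k := by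
  refine homogeneousSubmodule_le_of_mul_le
    (fun k => (tail m μ d (k - 1)).comap (MvPolynomial.aeval Y).toLinearMap)
    (fun i => by simpa using hY i) (fun k hk => ?_) (Nat.succ_pos k) hP
  rw [Submodule.mul_le]
  intro p hp q hq
  obtain ⟨k, rfl⟩ := Nat.exists_eq_add_of_le' hk
  simp only [Submodule.mem_comap, AlgHom.toLinearMap_apply, map_mul] at hp hq ⊢
  rw [mul_comm]
  exact hS.mul_mem_tail_succ hq hp

/-- In the difference of two monomials one factor is a difference in `tail N`, and degree at least
two supplies another factor in `tail 0`, which raises the index. A correction in layer `N` hence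
leaves the nonlinear terms of index up to `N` unchanged. -/
theorem AdmissibleScale.aeval_add_sub_mem_tail (hS : AdmissibleScale m μ d) {ι : Type*}
    {Y w : ι → ℝ → ℝ} (hY : ∀ i, Y i ∈ tail m μ d 0) {N : ℕ} (hw : ∀ i, w i ∈ tail m μ d N)
    {k : ℕ} {P : MvPolynomial ι ℝ} (hP : P.IsHomogeneous (k + 2)) :
    MvPolynomial.aeval (Y + w) P - MvPolynomial.aeval Y P ∈ tail m μ d (N + 1) := by
  have hw0 : ∀ i, (Y + w) i ∈ tail m μ d 0 := fun i =>
    add_mem (hY i) (tail_antitone (Nat.zero_le N) (hw i))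
  let C : ℕ → Submodule ℝ (MvPolynomial ι ℝ) := fun k =>
    (tail m μ d (k - 1)).comap (MvPolynomial.aeval Y).toLinearMap ⊓
      (tail m μ d (k - 1)).comap (MvPolynomial.aeval (Y + w)).toLinearMap ⊓
      -- The shift is `0` for linear forms and `1` from degree two on; no further gain is needed.
      (tail m μ d (N + min (k - 1) 1)).comap
        ((MvPolynomial.aeval (Y + w)).toLinearMap - (MvPolynomial.aeval Y).toLinearMap)
  suffices hC : ∀ k, 1 ≤ k → C k * C 1 ≤ C (k + 1) by
    have h := (homogeneousSubmodule_le_of_mul_le C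
      (fun i => ⟨⟨by simpa using hY i, by simpa using hw0 i⟩, by simpa using hw i⟩)
      hC (Nat.succ_pos (k + 1)) hP).2
    rwa [show min ((k + 1).succ - 1) 1 = 1 by omega] at h
  intro k hk
  rw [Submodule.mul_le]
  rintro p ⟨⟨hp, hp'⟩, hpd⟩ q ⟨⟨hq, hq'⟩, hqd⟩
  obtain ⟨k, rfl⟩ := Nat.exists_eq_add_of_le' hk
  simp only [SetLike.mem_coe, Submodule.mem_comap, AlgHom.toLinearMap_apply, LinearMap.sub_apply,
    Nat.add_sub_cancel, tsub_self, Nat.zero_min, Nat.add_zero] at hp hp' hpd hq hq' hqd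
  refine ⟨⟨?_, ?_⟩, ?_⟩ <;>
    simp only [SetLike.mem_coe, Submodule.mem_comap, AlgHom.toLinearMap_apply, map_mul,
      LinearMap.sub_apply, Nat.add_sub_cancel]
  · rw [mul_comm]; exact hS.mul_mem_tail_succ hq hp
  · rw [mul_comm]; exact hS.mul_mem_tail_succ hq' hp'
  · have e : MvPolynomial.aeval (Y + w) p * MvPolynomial.aeval (Y + w) q -
        MvPolynomial.aeval Y p * MvPolynomial.aeval Y q =
        MvPolynomial.aeval (Y + w) p * (MvPolynomial.aeval (Y + w) q - MvPolynomial.aeval Y q) +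
        MvPolynomial.aeval Y q * (MvPolynomial.aeval (Y + w) p - MvPolynomial.aeval Y p) := by
      ring
    rw [e, show min (k + 1) 1 = 1 by omega]
    exact add_mem (hS.mul_mem_tail_succ (tail_antitone (Nat.zero_le k) hp') hqd)
      (hS.mul_mem_tail_succ hq (tail_antitone (Nat.le_add_right _ _) hpd))

/-! ### The formal solution. -/

/-- `Y` solves the truncated system up to terms of index at least `N`. -/
def IsFormalSolution (m : ℕ) (μ : ℕ → ℝ) (d : ℕ → ℕ) {n : ℕ} (A : Matrix (Fin n) (Fin n) ℝ)
    (P : ℕ → Fin n → MvPolynomial (Fin n) ℝ) (s : ℕ → Fin n → ℝ → ℝ) (N : ℕ)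
    (Y : Fin n → ℝ → ℝ) : Prop :=
  (∀ i, Y i ∈ tail m μ d 0) ∧ ∃ r : Fin n → ℝ → ℝ, (∀ i, r i ∈ tail m μ d N) ∧
    EventuallySolves A Y (fun i => ∑ l ∈ Finset.range N, MvPolynomial.aeval Y (P l i) +
      ∑ k ∈ Finset.range N, s k i + r i)

theorem IsFormalSolution.exists_succ (hS : AdmissibleScale m μ d) {n : ℕ}
    {A : Matrix (Fin n) (Fin n) ℝ} (hA : PositiveSpectrum A)
    {P : ℕ → Fin n → MvPolynomial (Fin n) ℝ}
    (hP : ∀ l i, (P l i).IsHomogeneous (l + 2)) {s : ℕ → Fin n → ℝ → ℝ}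
    (hs : ∀ k i, s k i ∈ layer m μ d k) {N : ℕ} {Y : Fin n → ℝ → ℝ}
    (hY : IsFormalSolution m μ d A P s N Y) :
    ∃ w : Fin n → ℝ → ℝ, (∀ i, w i ∈ layer m μ d N) ∧
      IsFormalSolution m μ d A P s (N + 1) (Y + w) := by
  obtain ⟨hY0, r, hr, hYr⟩ := hY
  have hr' : ∀ i, ∃ h ∈ layer m μ d N, ∃ r₁ ∈ tail m μ d (N + 1),
      h + r₁ = r i - MvPolynomial.aeval Y (P N i) - s N i := fun i => by
    rw [← Submodule.mem_sup, ← tail_eq]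
    exact sub_mem (sub_mem (hr i) (tail_antitone (Nat.le_succ N)
      (hS.aeval_mem_tail hY0 (hP N i)))) (layer_le_tail le_rfl (hs N i))
  choose h hh r₁ hr₁ e using hr'
  -- The correction `w` answers the forcing `-h`, cancelling the layer-`N` part of the residual. The
  -- new polynomial `P N` has degree `N + 2`, so its value at `Y` already lies beyond layer `N`.
  obtain ⟨w, r₂, hw, hr₂, hwr⟩ := neg_mem (hS.mem_solvable hA hh)
  refine ⟨w, hw, fun i => add_mem (hY0 i) (layer_le_tail (Nat.zero_le N) (hw i)),
    fun i => r₁ i + r₂ i - ∑ l ∈ Finset.range (N + 1), (MvPolynomial.aeval (Y + w) (P l i) -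
      MvPolynomial.aeval Y (P l i)), fun i => ?_, ?_⟩
  · exact sub_mem (add_mem (hr₁ i) (hr₂ i)) (sum_mem fun l _ =>
      hS.aeval_add_sub_mem_tail hY0 (fun i => layer_le_tail le_rfl (hw i)) (hP l i))
  · convert hYr.add hwr using 1
    ext1 i
    have e' := e i
    simp only [Pi.add_apply, Pi.neg_apply, Finset.sum_sub_distrib]
    rw [Finset.sum_range_succ (fun l => MvPolynomial.aeval Y (P l i)),
      Finset.sum_range_succ (fun k => s k i)]
    linear_combination e'

theorem exists_formalSolution (hS : AdmissibleScale m μ d) {n : ℕ}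
    {A : Matrix (Fin n) (Fin n) ℝ} (hA : PositiveSpectrum A)
    {P : ℕ → Fin n → MvPolynomial (Fin n) ℝ}
    (hP : ∀ l i, (P l i).IsHomogeneous (l + 2)) {s : ℕ → Fin n → ℝ → ℝ}
    (hs : ∀ k i, s k i ∈ layer m μ d k) :
    ∃ q : ℕ → Fin n → ℝ → ℝ, (∀ k i, q k i ∈ layer m μ d k) ∧
      ∀ N, IsFormalSolution m μ d A P s N (∑ k ∈ Finset.range N, q k) := by
  have h0 : IsFormalSolution m μ d A P s 0 0 :=
    ⟨fun i => zero_mem _, 0, fun i => zero_mem _,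
      fun i => .of_forall fun t => by simp⟩
  choose w hw hwY using
    fun (N : ℕ) (Y : {Y // IsFormalSolution m μ d A P s N Y}) => Y.2.exists_succ hS hA hP hs
  let Y : (N : ℕ) → {Y // IsFormalSolution m μ d A P s N Y} := fun N =>
    Nat.rec ⟨0, h0⟩ (fun N Y => ⟨Y.1 + w N Y, hwY N Y⟩) N
  refine ⟨fun k => w k (Y k), fun k => hw k (Y k), fun N => ?_⟩
  have : ∑ k ∈ Finset.range N, w k (Y k) = (Y N).1 := by
    induction N with
    | zero => rfl
    | succ N ih => rw [Finset.sum_range_succ, ih]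
  rw [this]
  exact (Y N).2

/-! ### Exponential stability and a Lyapunov estimate. -/

section
attribute [local instance] Matrix.linftyOpNormedRing Matrix.linftyOpNormedAlgebra

/-- By Gelfand's formula the powers are eventually bounded by `r ^ k` for some `r < 1`. -/
theorem tendsto_matrix_pow_of_spectrum {n : ℕ} {M : Matrix (Fin n) (Fin n) ℂ}
    (hM : ∀ z ∈ spectrum ℂ M, ‖z‖ < 1) : Tendsto (fun k : ℕ => M ^ k) atTop (𝓝 0) := by
  have hr : spectralRadius ℂ M < 1 := by
    rcases (spectrum ℂ M).eq_empty_or_nonempty with h | h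
    · simp [spectralRadius, h]
    · exact_mod_cast spectrum.spectralRadius_lt_of_forall_lt_of_nonempty h (r := 1)
        fun z hz => by exact_mod_cast hM z hz
  obtain ⟨r, hr0, hr1⟩ := ENNReal.lt_iff_exists_nnreal_btwn.1 hr
  have h1 := (spectrum.pow_nnnorm_pow_one_div_tendsto_nhds_spectralRadius M).eventually_lt_const hr0
  have hr1 : (r : ℝ) < 1 := by exact_mod_cast hr1
  refine squeeze_zero_norm' (a := fun k => (r : ℝ) ^ k) ?_
    (tendsto_pow_atTop_nhds_zero_of_lt_one r.2 hr1)
  filter_upwards [h1, eventually_gt_atTop 0] with k hk hk0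
  have h2 : ((‖M ^ k‖₊ : ENNReal) ^ (1 / (k : ℝ))) ^ (k : ℝ) ≤ (r : ENNReal) ^ (k : ℝ) :=
    ENNReal.rpow_le_rpow hk.le (by positivity)
  rw [← ENNReal.rpow_mul, one_div_mul_cancel (by positivity), ENNReal.rpow_one,
    ENNReal.rpow_natCast] at h2
  exact_mod_cast h2

end

theorem exists_pos_forall_norm_one_sub_lt {s : Set ℂ} (hs : s.Finite) (h : ∀ z ∈ s, 0 < z.re) :
    ∃ c : ℝ, 0 < c ∧ ∀ z ∈ s, ‖1 - c * z‖ < 1 := by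
  have h1 : ∀ᶠ c : ℝ in 𝓝[>] 0, ∀ z ∈ s, ‖1 - c * z‖ < 1 := by
    rw [hs.eventually_all]
    intro z hz
    have h2 : Tendsto (fun c : ℝ => c * ‖z‖ ^ 2) (𝓝[>] 0) (𝓝 (0 * ‖z‖ ^ 2)) :=
      (tendsto_id.mono_left nhdsWithin_le_nhds).mul_const _
    rw [zero_mul] at h2
    filter_upwards [h2.eventually_lt_const (show 0 < 2 * z.re by linarith [h z hz]),
      self_mem_nhdsWithin] with c hc hc0
    have hc0 : 0 < c := hc0
    have e : ‖1 - (c : ℂ) * z‖ ^ 2 = 1 - c * (2 * z.re - c * ‖z‖ ^ 2) := by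
      rw [← Complex.normSq_eq_norm_sq, ← Complex.normSq_eq_norm_sq, Complex.normSq_apply,
        Complex.normSq_apply]
      simp
      ring
    have : 0 < c * (2 * z.re - c * ‖z‖ ^ 2) := mul_pos hc0 (by linarith)
    nlinarith [norm_nonneg (1 - (c : ℂ) * z)]
  obtain ⟨c, hc, hc0⟩ := (h1.and self_mem_nhdsWithin).exists
  exact ⟨c, hc0, hc⟩

/-- An Euler step `1 - c A` with small `c` maps the eigenvalues into the open unit disc, so its
powers tend to zero. This replaces estimates on `exp (-tA)`. -/
theorem exists_norm_pow_one_sub_le {n : ℕ} {A : Matrix (Fin n) (Fin n) ℝ}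
    (hA : PositiveSpectrum A) : ∃ (c : ℝ) (K : ℕ), 0 < c ∧
      ‖(1 - c • Matrix.toEuclideanCLM (n := Fin n) (𝕜 := ℝ) A) ^ K‖ ≤ 1 / 2 := by
  set Ac := A.map (fun a : ℝ => (a : ℂ)) with hAc
  have hspec : ∀ z ∈ spectrum ℂ Ac, 0 < z.re := fun z hz => by
    by_contra h
    exact hz (isUnit_sub_of_re_nonpos hA (not_lt.1 h))
  obtain ⟨c, hc, hcs⟩ := exists_pos_forall_norm_one_sub_lt (Matrix.finite_spectrum Ac) hspec
  refine ⟨c, ?_⟩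
  have hc' : (c : ℂ) ≠ 0 := by exact_mod_cast hc.ne'
  have hM : ∀ w ∈ spectrum ℂ (1 - (c : ℂ) • Ac), ‖w‖ < 1 := by
    intro w hw
    have hz : (1 - w) / c ∈ spectrum ℂ Ac := by
      by_contra hz
      have hu : IsUnit (algebraMap ℂ _ ((1 - w) / c) - Ac) := not_not.1 hz
      apply hw
      have := ((isUnit_iff_ne_zero.2 (neg_ne_zero.2 hc')).map
        (algebraMap ℂ (Matrix (Fin n) (Fin n) ℂ))).mul hu
      rw [spectrum.mem_resolventSet_iff]
      convert this using 1
      rw [Algebra.algebraMap_eq_smul_one, Algebra.algebraMap_eq_smul_one,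
        Algebra.algebraMap_eq_smul_one, smul_mul_assoc, one_mul, smul_sub, smul_smul,
        show -(c : ℂ) * ((1 - w) / c) = w - 1 by field_simp; ring]
      module
    have := hcs _ hz
    rwa [mul_div_cancel₀ _ hc', sub_sub_cancel] at this
  have h1 := tendsto_matrix_pow_of_spectrum hM
  have h2 : Tendsto (fun k : ℕ => (1 - c • A) ^ k) atTop (𝓝 0) := by
    have hmap : ∀ k : ℕ, ((1 - c • A) ^ k) = ((1 - (c : ℂ) • Ac) ^ k).map Complex.re := fun k => by
      have e : (1 - (c : ℂ) • Ac) = Complex.ofRealHom.mapMatrix (1 - c • A) := by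
        rw [map_sub, map_one, hAc]
        congr 1
        ext i j
        simp
      rw [e, ← map_pow]
      ext i j
      simp
    simp_rw [hmap]
    have hcont : Continuous fun M : Matrix (Fin n) (Fin n) ℂ => M.map Complex.re :=
      continuous_id.matrix_map Complex.continuous_re
    have h3 := (hcont.tendsto 0).comp h1
    rw [Matrix.map_zero _ Complex.zero_re] at h3
    exact h3
  have hcont : Continuous (Matrix.toEuclideanCLM (n := Fin n) (𝕜 := ℝ)) :=
    LinearMap.continuous_of_finiteDimensional
      (Matrix.toEuclideanCLM (n := Fin n) (𝕜 := ℝ)).toAlgEquiv.toLinearMap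
  have h3 := ((hcont.tendsto 0).comp h2).norm
  rw [map_zero, norm_zero] at h3
  obtain ⟨K, hK⟩ := (h3.eventually_le_const (show (0 : ℝ) < 1 / 2 by norm_num)).exists
  refine ⟨K, hc, ?_⟩
  simpa using hK

/-- A Lyapunov form for the system `x' = -T x`. -/
theorem exists_lyapunov {E : Type*} [NormedAddCommGroup E] [InnerProductSpace ℝ E]
    (T : E →L[ℝ] E) {c : ℝ} (hc : 0 < c) {K : ℕ} (hK : ‖(1 - c • T) ^ K‖ ≤ 1 / 2) :
    ∃ (b : E →L[ℝ] E →L[ℝ] ℝ) (κ : ℝ), 0 < κ ∧ (∀ x y, b x y = b y x) ∧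
      (∀ x, κ * ‖x‖ ^ 2 ≤ b x (T x)) ∧ ∀ x, 3 / 4 * ‖x‖ ^ 2 ≤ b x x := by
  set B := 1 - c • T with hB
  -- The truncated Lyapunov sum for the discrete system `x ↦ B x`. It telescopes under `B`, and `‖B
  -- ^ K‖ ≤ 1/2` bounds the boundary term by a quarter of `‖x‖ ^ 2`; expanding `B = 1 - c T` then
  -- yields coercivity of `b x (T x)`.
  let b : E →L[ℝ] E →L[ℝ] ℝ := ∑ j ∈ Finset.range K, (innerSL ℝ).bilinearComp (B ^ j) (B ^ j)
  have hb : ∀ x y, b x y = ∑ j ∈ Finset.range K, inner ℝ ((B ^ j) x) ((B ^ j) y) := fun x y => by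
    simp [b]
  have hsymm : ∀ x y, b x y = b y x := fun x y => by
    rw [hb, hb]
    exact Finset.sum_congr rfl fun j _ => real_inner_comm _ _
  have hnonneg : ∀ x, 0 ≤ b x x := fun x => by
    rw [hb]
    exact Finset.sum_nonneg fun j _ => real_inner_self_nonneg
  have hstep : ∀ x, b (B x) (B x) = b x x - ‖x‖ ^ 2 + ‖(B ^ K) x‖ ^ 2 := fun x => by
    have h1 := Finset.sum_range_succ (fun j => ‖(B ^ j) x‖ ^ 2) K
    rw [Finset.sum_range_succ'] at h1
    simp only [hb, real_inner_self_eq_norm_sq, ← mul_apply_eq_comp, ← pow_succ]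
    simp only [pow_zero, one_apply_eq_self] at h1
    linarith
  have hdec : ∀ x, ‖(B ^ K) x‖ ^ 2 ≤ 1 / 4 * ‖x‖ ^ 2 := fun x => by
    have h1 := (B ^ K).le_of_opNorm_le hK x
    calc ‖(B ^ K) x‖ ^ 2 ≤ (1 / 2 * ‖x‖) ^ 2 := by gcongr
      _ = _ := by ring
  refine ⟨b, 3 / (8 * c), by positivity, hsymm, fun x => ?_, fun x => ?_⟩
  · have h1 := hstep x
    have h2 : b (B x) (B x) = b x x - 2 * c * b x (T x) + c ^ 2 * b (T x) (T x) := by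
      simp only [hB, sub_apply, one_apply_eq_self,
        smul_apply, map_sub, map_smul, smul_eq_mul, hsymm (T x) x]
      ring
    have h3 := mul_nonneg (sq_nonneg c) (hnonneg (T x))
    rw [div_mul_eq_mul_div, div_le_iff₀ (by positivity)]
    nlinarith [hdec x]
  · linarith [hstep x, hnonneg (B x), hdec x]

theorem le_of_hasDerivAt_le_neg_mul {w w' : ℝ → ℝ} {c a : ℝ}
    (hd : ∀ t, a ≤ t → HasDerivAt w (w' t) t) (hle : ∀ t, a ≤ t → w' t ≤ -c * w t)
    (ha : w a ≤ 0) {t : ℝ} (ht : a ≤ t) : w t ≤ 0 := by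
  have hd' : ∀ t, a ≤ t → HasDerivAt (fun t => w t * Real.exp (c * t))
      (w' t * Real.exp (c * t) + w t * (Real.exp (c * t) * c)) t := fun t ht =>
    (hd t ht).mul (by simpa using ((hasDerivAt_id t).const_mul c).exp)
  have hanti : AntitoneOn (fun t => w t * Real.exp (c * t)) (Set.Ici a) := by
    refine antitoneOn_of_deriv_nonpos (convex_Ici a)
      (fun t ht => (hd' t ht).continuousAt.continuousWithinAt)
      (fun t ht => (hd' t (interior_subset ht)).differentiableAt.differentiableWithinAt)
      fun t ht => ?_
    have ht := interior_subset ht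
    rw [(hd' t ht).deriv]
    nlinarith [hle t ht, Real.exp_pos (c * t)]
  have h1 := hanti (Set.mem_Ici.2 le_rfl) ht ht
  by_contra! h
  nlinarith [mul_pos h (Real.exp_pos (c * t)), Real.exp_pos (c * a)]

/-- Perturbations of an exponentially stable linear system decay like their slowly varying
forcing. -/
theorem exists_isBigO_of_stable {n : ℕ} {A : Matrix (Fin n) (Fin n) ℝ} (hA : PositiveSpectrum A) :
    ∃ ε : ℝ, 0 < ε ∧ ∀ (v g : ℝ → Vec n) (ψ ρ : ℝ → ℝ) (C : ℝ), (∀ t, 0 < ψ t) →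
      (∀ᶠ t in atTop, HasDerivAt ψ (ρ t * ψ t) t) → Tendsto ρ atTop (𝓝 0) →
      (∀ᶠ t in atTop, HasDerivAt v (-(Matrix.toEuclideanLin A (v t)) + g t) t) →
      (∀ᶠ t in atTop, ‖g t‖ ≤ ε * ‖v t‖ + C * ψ t) → v =O[atTop] ψ := by
  obtain ⟨c, K, hc, hK⟩ := exists_norm_pow_one_sub_le hA
  obtain ⟨b, κ, hκ, hsymm, hT, hpos⟩ := exists_lyapunov _ hc hK
  set β := ‖b‖ + 1 with hβ
  have hβ0 : 0 < β := by positivity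
  have hb : ∀ x y, b x y ≤ β * ‖x‖ * ‖y‖ := fun x y =>
    (le_abs_self _).trans ((b.le_opNorm₂ x y).trans (by gcongr; linarith))
  -- This `ε` costs at most a quarter of the coercivity `κ`; the forcing costs another quarter after
  -- completing the square, which produces `D`.
  refine ⟨κ / (4 * β), by positivity, fun v g ψ ρ C hψ hψd hρ hv hg => ?_⟩
  set γ := κ / (2 * β) with hγ
  have hγ0 : 0 < γ := by positivity
  set D := 2 * (β * C) ^ 2 / κ with hD
  obtain ⟨a, ha⟩ := eventually_atTop.1 (hψd.and (hv.and (hg.and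
    (hρ.eventually_const_lt (show -(γ / 4) < 0 by linarith)))))
  -- The first bound lets `M ψ²` dominate the forcing; the second makes the comparison function
  -- nonpositive at `a`.
  set M := max (2 * D / γ) (b (v a) (v a) / ψ a ^ 2) with hM
  have hMD : D ≤ M * (γ / 2) := by
    have : 2 * D / γ ≤ M := le_max_left _ _
    rw [div_le_iff₀ hγ0] at this
    linarith
  have hM0 : 0 ≤ M := le_max_of_le_left (by positivity)
  have hbd : ∀ t, a ≤ t → b (v t) (v t) - M * ψ t ^ 2 ≤ 0 := by
    intro t ht
    refine le_of_hasDerivAt_le_neg_mul (c := γ) (a := a)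
      (w := fun t => b (v t) (v t) - M * ψ t ^ 2)
      (w' := fun t => 2 * b (v t) (-(Matrix.toEuclideanLin A (v t)) + g t) -
        M * (2 * ψ t * (ρ t * ψ t)))
      (fun t ht => ?_) (fun t ht => ?_) ?_ ht
    · obtain ⟨h1, h2, -⟩ := ha t ht
      refine HasDerivAt.sub ?_ ?_
      · have h3 := (b.hasFDerivAt.comp_hasDerivAt t h2).clm_apply h2
        refine h3.congr_deriv ?_
        simp only [Function.comp_apply]
        rw [hsymm (_ + g t)]
        ring
      · exact ((h1.pow 2).const_mul M).congr_deriv (by simp)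
    · obtain ⟨-, -, h3, h4⟩ := ha t ht
      have e : b (v t) (-(Matrix.toEuclideanLin A (v t)) + g t) =
          -(b (v t) (Matrix.toEuclideanCLM (n := Fin n) (𝕜 := ℝ) A (v t))) + b (v t) (g t) := by
        rw [map_add, map_neg]; rfl
      have h5 := hT (v t)
      have h6 := hb (v t) (v t)
      have h7 : b (v t) (g t) ≤ β * ‖v t‖ * (κ / (4 * β) * ‖v t‖ + C * ψ t) :=
        (hb _ _).trans (by gcongr)
      have h8 : β * ‖v t‖ * (κ / (4 * β) * ‖v t‖ + C * ψ t) =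
          κ / 4 * ‖v t‖ ^ 2 + (β * C * ψ t) * ‖v t‖ := by field_simp
      have h9 : (β * C * ψ t) * ‖v t‖ ≤ κ / 4 * ‖v t‖ ^ 2 + D / 2 * ψ t ^ 2 := by
        have e9 : κ / 4 * ‖v t‖ ^ 2 + D / 2 * ψ t ^ 2 - (β * C * ψ t) * ‖v t‖ =
            (κ * ‖v t‖ - 2 * (β * C * ψ t)) ^ 2 / (4 * κ) := by
          rw [hD]; field_simp; ring
        have : 0 ≤ (κ * ‖v t‖ - 2 * (β * C * ψ t)) ^ 2 / (4 * κ) := by positivity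
        linarith
      have h10 : γ * b (v t) (v t) ≤ κ / 2 * ‖v t‖ ^ 2 := by
        calc γ * b (v t) (v t) ≤ γ * (β * ‖v t‖ * ‖v t‖) := by gcongr
          _ = κ / 2 * ‖v t‖ ^ 2 := by rw [hγ]; field_simp
      have h11 : M * (2 * ψ t * (ρ t * ψ t)) ≥ -(M * (γ / 2)) * ψ t ^ 2 := by
        have := mul_nonneg (mul_nonneg hM0 (sq_nonneg (ψ t))) (show 0 ≤ ρ t + γ / 4 by linarith)
        nlinarith
      have h12 := mul_le_mul_of_nonneg_right hMD (sq_nonneg (ψ t))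
      simp only [e]
      nlinarith [mul_nonneg hκ.le (sq_nonneg ‖v t‖)]
    · have : b (v a) (v a) / ψ a ^ 2 ≤ M := le_max_right _ _
      rw [div_le_iff₀ (pow_pos (hψ a) 2)] at this
      linarith
  refine IsBigO.of_bound (Real.sqrt (2 * M)) ?_
  filter_upwards [eventually_ge_atTop a] with t ht
  rw [Real.norm_of_nonneg (hψ t).le]
  refine (sq_le_sq₀ (norm_nonneg _) (mul_nonneg (Real.sqrt_nonneg _) (hψ t).le)).1 ?_
  rw [mul_pow, Real.sq_sqrt (by linarith)]
  nlinarith [hpos (v t), hbd t ht, sq_nonneg ‖v t‖, mul_nonneg hM0 (sq_nonneg (ψ t))]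

/-! ### Translation between `coeffs` and `powTrigClass`. -/

theorem iterLogVec_eventually_pos (k : ℕ) : ∀ᶠ t in atTop, ∀ j, 0 < iterLogVec k t j := by
  rw [eventually_all]
  intro j
  refine Fin.cases (.of_forall fun t => ?_) (fun j => ?_) j
  · simpa [iterLogVec] using Real.exp_pos t
  · simpa [iterLogVec] using (tendsto_iterLog j).eventually_gt_atTop 0

/-- On the curve `iterLogVec k`, a product of powers and trigonometric functions is the product of
its factors at the separate levels. -/
theorem prod_iterLogVec_eventuallyEq (k : ℕ) (α : Fin (k + 2) → ℝ) (h0 : α 0 = 0)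
    (ω : Fin (k + 1) → ℝ) (σ : Fin (k + 1) → ℝ → ℝ) :
    (fun t => (∏ j, iterLogVec k t j ^ α j) * ∏ j, σ j (ω j * iterLogVec k t j.succ)) =ᶠ[atTop]
      ∏ j : Fin (k + 1), fun t => logPow j (α j.succ) t * σ j (ω j * iterLog j t) := by
  filter_upwards [eventually_all.2 fun j : Fin (k + 1) => iterLog_rpow_eventuallyEq j (α j.succ)]
    with t ht
  rw [Fin.prod_univ_succ, h0, Real.rpow_zero, one_mul, ← Finset.prod_mul_distrib,
    Finset.prod_apply]
  refine Finset.prod_congr rfl fun j _ => ?_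
  simp only [iterLogVec, Fin.cons_succ]
  rw [ht j]

theorem coeffs_eq_prod_univ (m k : ℕ) : coeffs m k = ∏ j : Fin (k + 1), level m j :=
  Finset.prod_range _

theorem exists_mem_coeffs {m k n : ℕ} {p : (Fin (k + 2) → ℝ) → Vec n}
    (hp : p ∈ powTrigClass m k n) (i : Fin n) :
    ∃ s ∈ coeffs m k, (fun t => p (iterLogVec k t) i) =ᶠ[atTop] s := by
  obtain ⟨N, ξ, α, ω, σ, hα, hσ, hp⟩ := hp
  have hα' : ∀ l (j : Fin (k + 2)), (j : ℕ) ≤ m + 1 → α l j = 0 := fun l j hj => by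
    rcases hj.lt_or_eq with h | h
    · simpa using (hα l).1 j h
    · simpa using (hα l).2 j h
  refine ⟨∑ l, ξ l i • ∏ j : Fin (k + 1), fun t => logPow j (α l j.succ) t *
    σ l j (ω l j * iterLog j t), sum_mem fun l _ => Submodule.smul_mem _ _ ?_, ?_⟩
  · rw [coeffs_eq_prod_univ]
    simp only [level]
    rw [Submodule.prod_span]
    refine Submodule.subset_span ((Set.mem_finsetProd _ _ _).2 ⟨_, fun {j} _ =>
      ⟨α l j.succ, ω l j, σ l j, fun hj => hα' l _ (by simpa using hj), hσ l j, rfl⟩, rfl⟩)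
  · filter_upwards [iterLogVec_eventually_pos k, eventually_all.2 fun l =>
      prod_iterLogVec_eventuallyEq k (α l) (hα' l 0 (by simp)) (ω l) (σ l)] with t hpos ht
    rw [hp _ hpos]
    simp [← ht, mul_comm]

theorem powTrigClass_add_mem {m k n : ℕ} {p q : (Fin (k + 2) → ℝ) → Vec n}
    (hp : p ∈ powTrigClass m k n) (hq : q ∈ powTrigClass m k n) : p + q ∈ powTrigClass m k n := by
  obtain ⟨N, ξ, α, ω, σ, hα, hσ, hp⟩ := hp
  obtain ⟨N', ξ', α', ω', σ', hα', hσ', hq⟩ := hq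
  refine ⟨N + N', Fin.append ξ ξ', Fin.append α α', Fin.append ω ω', Fin.append σ σ',
    fun i => ?_, fun i => ?_, fun z hz => ?_⟩
  · refine Fin.addCases (fun i => ?_) (fun i => ?_) i
    · simpa using hα i
    · simpa using hα' i
  · refine Fin.addCases (fun i => ?_) (fun i => ?_) i
    · simpa using hσ i
    · simpa using hσ' i
  · simp [Fin.sum_univ_add, hp z hz, hq z hz]

theorem powTrigClass_zero_mem (m k n : ℕ) : 0 ∈ powTrigClass m k n :=
  ⟨0, Fin.elim0, Fin.elim0, Fin.elim0, Fin.elim0, fun i => i.elim0, fun i => i.elim0,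
    fun z _ => by simp⟩

/-- Quantifying over all `ξ` lets the span induction absorb scalars into the vector. -/
theorem exists_powTrigClass_smul {m k : ℕ} (n : ℕ) {x : ℝ → ℝ} (hx : x ∈ coeffs m k) :
    ∀ ξ : Vec n, ∃ p ∈ powTrigClass m k n,
      (fun t => p (iterLogVec k t)) =ᶠ[atTop] fun t => x t • ξ := by
  rw [coeffs_eq_prod_univ] at hx
  simp only [level] at hx
  rw [Submodule.prod_span] at hx
  induction hx using Submodule.span_induction with
  | zero => exact fun ξ => ⟨0, powTrigClass_zero_mem m k n, .of_forall fun t => by simp⟩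
  | add x y _ _ hx hy =>
    intro ξ
    obtain ⟨p, hp, hpe⟩ := hx ξ
    obtain ⟨q, hq, hqe⟩ := hy ξ
    refine ⟨p + q, powTrigClass_add_mem hp hq, ?_⟩
    filter_upwards [hpe, hqe] with t h1 h2
    simp [h1, h2, add_smul]
  | smul c x _ hx =>
    intro ξ
    obtain ⟨p, hp, hpe⟩ := hx (c • ξ)
    refine ⟨p, hp, hpe.trans (.of_forall fun t => ?_)⟩
    simp [smul_smul, mul_comm]
  | mem x hx =>
    intro ξ
    obtain ⟨g, hg, rfl⟩ := (Set.mem_finsetProd _ _ _).1 hx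
    choose a ω σ ha hσ hg using fun j => hg (Finset.mem_univ j)
    refine ⟨fun z => ((∏ j, z j ^ (Fin.cons 0 a : Fin (k + 2) → ℝ) j) *
      ∏ j : Fin (k + 1), σ j (ω j * z j.succ)) • ξ,
      ⟨1, fun _ => ξ, fun _ => Fin.cons 0 a, fun _ => ω, fun _ => σ, fun _ => ⟨?_, ?_⟩,
        fun _ => hσ, fun z _ => by simp⟩, ?_⟩
    · refine fun j => Fin.cases (by simp) (fun j hj => ?_) j
      simpa using ha j (by simp at hj; omega)
    · refine fun j => Fin.cases (by simp) (fun j hj => ?_) j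
      simpa using ha j (by simp at hj; omega)
    · filter_upwards [prod_iterLogVec_eventuallyEq k (Fin.cons 0 a) rfl ω σ] with t ht
      simp only [ht, Fin.cons_succ, Finset.prod_apply, hg]

theorem exists_mem_powTrigClass {m k n : ℕ} {x : Fin n → ℝ → ℝ} (hx : ∀ i, x i ∈ coeffs m k) :
    ∃ p ∈ powTrigClass m k n, ∀ᶠ t in atTop, ∀ i, p (iterLogVec k t) i = x i t := by
  choose p hp hpe using fun i =>
    exists_powTrigClass_smul n (hx i) (EuclideanSpace.single i (1 : ℝ))
  let M : AddSubmonoid ((Fin (k + 2) → ℝ) → Vec n) :=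
    { carrier := powTrigClass m k n
      add_mem' := powTrigClass_add_mem
      zero_mem' := powTrigClass_zero_mem m k n }
  refine ⟨∑ i, p i, sum_mem (S := M) fun i _ => hp i, ?_⟩
  filter_upwards [eventually_all.2 hpe] with t ht i
  simp [Finset.sum_apply, ht, Pi.single_apply]

/-! ### Vector-valued estimates and the nonlinearity near zero. -/

theorem isBigO_of_components {n : ℕ} {u : ℝ → Vec n} {g : ℝ → ℝ} {l : Filter ℝ}
    (h : ∀ i, (fun t => u t i) =O[l] g) : u =O[l] g := by
  refine IsBigO.trans ?_ (isBigO_pi.2 h)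
  exact (PiLp.continuousLinearEquiv 2 ℝ fun _ : Fin n => ℝ).symm.toContinuousLinearMap.isBigO_comp
    (fun t i => u t i) l

theorem hasDerivAt_of_components {n : ℕ} {u : ℝ → Vec n} {u' : Vec n} {t : ℝ}
    (h : ∀ i, HasDerivAt (fun t => u t i) (u' i) t) : HasDerivAt u u' t :=
  (PiLp.continuousLinearEquiv 2 ℝ fun _ : Fin n => ℝ).symm.toContinuousLinearMap.hasFDerivAt
    |>.comp_hasDerivAt t (hasDerivAt_pi.2 h)

/-- Strict differentiability is what is needed: it gives `P x - P x' = o(x - x')` as both points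
tend to zero. In the product rule each term carries a factor vanishing at the origin. -/
theorem hasStrictFDerivAt_eval_homogeneous {n k : ℕ} {P : MvPolynomial (Fin n) ℝ}
    (hP : P.IsHomogeneous (k + 2)) :
    HasStrictFDerivAt (fun x : Vec n => MvPolynomial.eval (fun j => x j) P)
      (0 : Vec n →L[ℝ] ℝ) 0 := by
  let C : ℕ → Submodule ℝ (MvPolynomial (Fin n) ℝ) := fun k =>
    { carrier := {P | MvPolynomial.eval 0 P = 0 ∧ ∃ L : Vec n →L[ℝ] ℝ, (2 ≤ k → L = 0) ∧
        HasStrictFDerivAt (fun x : Vec n => MvPolynomial.eval (fun j => x j) P) L 0}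
      zero_mem' := ⟨map_zero _, 0, fun _ => rfl, by
        simpa using hasStrictFDerivAt_const (0 : ℝ) (0 : Vec n)⟩
      add_mem' := by
        rintro p q ⟨hp, L, hL, hd⟩ ⟨hq, L', hL', hd'⟩
        refine ⟨by rw [map_add, hp, hq, add_zero], L + L', fun h => by simp [hL h, hL' h], ?_⟩
        simpa using hd.fun_add hd'
      smul_mem' := by
        rintro c p ⟨hp, L, hL, hd⟩
        refine ⟨by rw [MvPolynomial.smul_eval, hp, mul_zero], c • L, fun h => by simp [hL h], ?_⟩
        simpa using hd.fun_const_smul c }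
  obtain ⟨-, L, hL, hd⟩ := homogeneousSubmodule_le_of_mul_le C (fun i => ⟨by simp,
    EuclideanSpace.proj i, fun h => absurd h (by omega), by
      simpa using (EuclideanSpace.proj (𝕜 := ℝ) i).hasStrictFDerivAt (x := (0 : Vec n))⟩)
    (fun k hk => by
      rw [Submodule.mul_le]
      rintro p ⟨hp, L, hL, hd⟩ q ⟨hq, L', hL', hd'⟩
      refine ⟨by rw [map_mul, hp, zero_mul], 0, fun _ => rfl, ?_⟩
      have e : (fun j => (0 : Vec n) j) = (0 : Fin n → ℝ) := rfl
      have := hd.fun_mul hd'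
      rw [e, hp, hq, zero_smul, zero_smul, add_zero] at this
      simpa using this) (Nat.succ_pos (k + 1)) hP
  rwa [hL (by omega)] at hd

theorem hasStrictFDerivAt_of_isHomogeneousPolynomial {n k : ℕ} {H : Vec n → Vec n}
    (hH : IsHomogeneousPolynomial (k + 2) H) : HasStrictFDerivAt H (0 : Vec n →L[ℝ] Vec n) 0 := by
  obtain ⟨P, hP, hHP⟩ := hH
  rw [hasStrictFDerivAt_euclidean]
  intro i
  simpa [hHP] using hasStrictFDerivAt_eval_homogeneous (hP i)

/-- The term `g₁ = o(v)` is absorbed by `ε`, and `L_m ^ (-ν)` is an admissible comparison function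
since its logarithmic derivative `-ν L_{m+1}'` tends to zero. -/
theorem isBigO_logPow_of_stable {n : ℕ} {A : Matrix (Fin n) (Fin n) ℝ} (hA : PositiveSpectrum A)
    (m : ℕ) (ν : ℝ) {v g₁ g₂ : ℝ → Vec n} (h₁ : g₁ =o[atTop] v) (h₂ : g₂ =O[atTop] logPow m (-ν))
    (hv : ∀ᶠ t in atTop, HasDerivAt v (-(Matrix.toEuclideanLin A (v t)) + (g₁ t + g₂ t)) t) :
    v =O[atTop] logPow m (-ν) := by
  obtain ⟨ε, hε, H⟩ := exists_isBigO_of_stable hA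
  obtain ⟨C, hC⟩ := h₂.bound
  refine H v (fun t => g₁ t + g₂ t) (logPow m (-ν)) (fun t => -ν * iterLogDeriv (m + 1) t) C
    (logPow_pos m _) (hasDerivAt_logPow m _) ?_ hv ?_
  · simpa using (tendsto_iterLogDeriv_succ m).const_mul (-ν)
  · filter_upwards [h₁.bound hε, hC] with t h1 h2
    rw [Real.norm_of_nonneg (logPow_pos m _ t).le] at h2
    exact (norm_add_le _ _).trans (add_le_add h1 h2)

theorem aeval_apply {ι : Type*} (Y : ι → ℝ → ℝ) (P : MvPolynomial ι ℝ) (t : ℝ) :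
    MvPolynomial.aeval Y P t = MvPolynomial.eval (fun j => Y j t) P := by
  have := MvPolynomial.comp_aeval_apply (φ := Pi.evalAlgHom ℝ (fun _ : ℝ => ℝ) t) Y P
  simpa [MvPolynomial.aeval_eq_eval] using this

theorem isBigO_sub_sum_homogeneous {n : ℕ} {G : Vec n → Vec n} {H : ℕ → Vec n → Vec n}
    (hG : ∀ N : ℕ, 2 ≤ N → ∃ δ : ℝ, 0 < δ ∧
      (fun x => G x - ∑ m ∈ Finset.Icc 2 N, H m x) =O[𝓝 0] fun x => ‖x‖ ^ ((N : ℝ) + δ)) (N : ℕ) :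
    (fun x => G x - ∑ l ∈ Finset.range (N + 1), H (l + 2) x) =O[𝓝 0]
      fun x => ‖x‖ ^ (N + 2) := by
  obtain ⟨δ, hδ, h⟩ := hG (N + 2) (by omega)
  have e : ∀ x, ∑ m ∈ Finset.Icc 2 (N + 2), H m x = ∑ l ∈ Finset.range (N + 1), H (l + 2) x := by
    intro x
    rw [← Finset.Ico_add_one_right_eq_Icc, Finset.sum_Ico_eq_sum_range]
    exact Finset.sum_congr (by congr 1) fun l _ => by rw [add_comm]
  simp only [e] at h
  refine h.trans (IsBigO.of_bound 1 ?_)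
  filter_upwards [Metric.ball_mem_nhds (0 : Vec n) one_pos] with x hx
  have hx : ‖x‖ ≤ 1 := by simpa using (mem_ball_zero_iff.1 hx).le
  rw [one_mul, Real.norm_of_nonneg (by positivity), Real.norm_of_nonneg (by positivity),
    ← Real.rpow_natCast]
  exact Real.rpow_le_rpow_of_exponent_ge_of_imp (norm_nonneg x) hx (by linarith) fun _ h => by
    push_cast at h; linarith [(Nat.cast_nonneg N : (0 : ℝ) ≤ N)]

theorem isLittleO_of_isBigO_sub_sum {n : ℕ} {G : Vec n → Vec n} {H : ℕ → Vec n → Vec n}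
    (hH : ∀ m, 2 ≤ m → IsHomogeneousPolynomial m (H m))
    (hG : (fun x => G x - ∑ l ∈ Finset.range 1, H (l + 2) x) =O[𝓝 0] fun x => ‖x‖ ^ 2) :
    G =o[𝓝 0] fun x : Vec n => x := by
  have h1 := hG.trans_isLittleO (isLittleO_norm_pow_id one_lt_two)
  have h2 := (hasStrictFDerivAt_of_isHomogeneousPolynomial (hH 2 le_rfl)).hasFDerivAt.isLittleO
  have h0 : H 2 0 = 0 := by
    obtain ⟨P, hP, hHP⟩ := hH 2 le_rfl
    ext i
    rw [hHP]
    have := (hP i).coeff_eq_zero (d := 0) (by simp)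
    rw [← MvPolynomial.constantCoeff_eq] at this
    simpa [← MvPolynomial.constantCoeff_eq] using this
  simp only [h0, sub_zero, zero_apply] at h2
  simpa using h1.add h2

/-! ### Comparison of the solution with the formal expansion. -/

/-- The multiples `μ 0, 2 μ 0, …, (N + 1) μ 0` are distinct members of the scale. Hence a Taylor
remainder of order `N + 2` in `y` decays faster than `L_m ^ (-μ N)`. -/
theorem AdmissibleScale.le_nsmul (hS : AdmissibleScale m μ d) (N : ℕ) :
    μ N ≤ (N + 1) * μ 0 := by
  have key : ∀ N : ℕ, ∃ c, N ≤ c ∧ μ c = (N + 1) * μ 0 := by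
    intro N
    induction N with
    | zero => exact ⟨0, le_rfl, by simp⟩
    | succ N ih =>
      obtain ⟨c, hc, e⟩ := ih
      obtain ⟨c', hc'⟩ := hS.add (μ c) ⟨c, rfl⟩ (μ 0) ⟨0, rfl⟩
      have : c < c' := hS.strictMono.lt_iff_lt.1 (by linarith [hS.pos 0])
      refine ⟨c', by omega, ?_⟩
      rw [hc', e]
      push_cast
      ring
  obtain ⟨c, hc, e⟩ := key N
  rw [← e]
  exact hS.strictMono.monotone hc

/-- The `L_m`-scaled coefficients of an expansion, as functions of time. -/
theorem exists_layer_eventuallyEq {n : ℕ} {phat : (k : ℕ) → (Fin (d k + 2) → ℝ) → Vec n}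
    (hphat : ∀ k, phat k ∈ powTrigClass m (d k) n) :
    ∃ s : ℕ → Fin n → ℝ → ℝ, (∀ k i, s k i ∈ layer m μ d k) ∧ ∀ k, ∀ᶠ t in atTop,
      iterLog m t ^ (-μ k) • phat k (iterLogVec (d k) t) = WithLp.toLp 2 fun i => s k i t := by
  choose s hs hse using fun k i => exists_mem_coeffs (hphat k) i
  refine ⟨fun k i => logPow m (-μ k) * s k i, fun k i =>
    Submodule.mul_mem_mul (Submodule.mem_span_singleton_self _) (hs k i), fun k => ?_⟩
  filter_upwards [eventually_all.2 (hse k), iterLog_rpow_eventuallyEq m (-μ k)] with t h1 h2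
  ext i
  simp [h1, h2]

theorem exists_powTrigClass_of_layer {n : ℕ} {q : ℕ → Fin n → ℝ → ℝ}
    (hq : ∀ k i, q k i ∈ layer m μ d k) :
    ∃ qhat : (k : ℕ) → (Fin (d k + 2) → ℝ) → Vec n, (∀ k, qhat k ∈ powTrigClass m (d k) n) ∧
      ∀ k, ∀ᶠ t in atTop,
        iterLog m t ^ (-μ k) • qhat k (iterLogVec (d k) t) = WithLp.toLp 2 fun i => q k i t := by
  choose x hx hxe using fun k i => Submodule.mem_span_singleton_mul.1 (hq k i)
  choose p hp hpe using fun k => exists_mem_powTrigClass (hx k)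
  refine ⟨p, hp, fun k => ?_⟩
  filter_upwards [hpe k, iterLog_rpow_eventuallyEq m (-μ k)] with t h1 h2
  ext i
  simp [h1, h2, ← hxe]

theorem AdmissibleScale.isBigO_of_mem_tail (hS : AdmissibleScale m μ d) {n N : ℕ} {ν : ℝ}
    (hν : ν < μ N) {x : Fin n → ℝ → ℝ} (hx : ∀ i, x i ∈ tail m μ d N) :
    (fun t => (WithLp.toLp 2 fun i => x i t : Vec n)) =O[atTop] logPow m (-ν) :=
  isBigO_of_components fun i => hS.tail_le_decay hν (hx i)

theorem logPow_pow (m : ℕ) (a : ℝ) (k : ℕ) (t : ℝ) : logPow m a t ^ k = logPow m (k * a) t := by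
  simp only [logPow, ← Real.exp_nat_mul]
  ring_nf

theorem exists_expansion (hS : AdmissibleScale m μ d) {n : ℕ} {A : Matrix (Fin n) (Fin n) ℝ}
    (hA : PositiveSpectrum A) {G : Vec n → Vec n} (hGexp : HasPolynomialExpansion G)
    {f y : ℝ → Vec n}
    (hy : ∀ᶠ t in atTop, HasDerivAt y (-(Matrix.toEuclideanLin A (y t)) + G (y t) + f t) t)
    (hylim : Tendsto y atTop (𝓝 0)) {phat : (k : ℕ) → (Fin (d k + 2) → ℝ) → Vec n}
    (hphat : ∀ k, phat k ∈ powTrigClass m (d k) n) (hfexp : HasExpansion m μ d f phat) :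
    ∃ qhat : (k : ℕ) → (Fin (d k + 2) → ℝ) → Vec n,
      (∀ k, qhat k ∈ powTrigClass m (d k) n) ∧ HasExpansion m μ d y qhat := by
  obtain ⟨H, hH, hG⟩ := hGexp
  choose P hP hHP using fun l : ℕ => hH (l + 2) (by omega)
  obtain ⟨s, hs, hse⟩ := exists_layer_eventuallyEq (μ := μ) hphat
  obtain ⟨q, hq, hqY⟩ := exists_formalSolution hS hA (P := P) (fun l i => hP l i) hs
  obtain ⟨qhat, hqhat, hqe⟩ := exists_powTrigClass_of_layer hq
  have hf : ∀ N, ∃ ν, μ N < ν ∧ (fun t => f t - ∑ k ∈ Finset.range (N + 1),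
      (WithLp.toLp 2 fun i => s k i t : Vec n)) =O[atTop] logPow m (-ν) := fun N => by
    obtain ⟨ν, hν, h⟩ := hfexp N
    refine ⟨ν, hν, (h.trans_eventuallyEq (iterLog_rpow_eventuallyEq m (-ν))).congr' ?_ .rfl⟩
    filter_upwards [(Finset.range (N + 1)).eventually_all.2 fun k _ => hse k] with t ht
    rw [Finset.sum_congr rfl ht]
  -- A priori decay: near zero `G (y) = o(y)`, so the solution decays almost as fast as the leading
  -- term of `f`.
  have hy0 : ∀ ν < μ 0, y =O[atTop] logPow m (-ν) := fun ν hν => by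
    refine isBigO_logPow_of_stable hA m ν (g₁ := fun t => G (y t)) (g₂ := f)
      ((isLittleO_of_isBigO_sub_sum hH (isBigO_sub_sum_homogeneous hG 0)).comp_tendsto hylim) ?_
      (by simpa only [add_assoc] using hy)
    obtain ⟨ν', hν', h⟩ := hf 0
    have h1 := h.trans (logPow_isBigO (b := -ν) (by linarith))
    have h2 := hS.isBigO_of_mem_tail hν (fun i => layer_le_tail le_rfl (hs 0 i))
    simpa using h1.add h2
  refine ⟨qhat, hqhat, fun N => ?_⟩
  obtain ⟨ν', hν', hfN⟩ := hf N
  obtain ⟨hY0, r, hr, hYr⟩ := hqY (N + 1)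
  set Y := ∑ k ∈ Finset.range (N + 1), q k with hY
  have hμ0 := hS.pos 0
  -- The three upper bounds come from the remainder of `f`, the residual of the formal solution and
  -- the Taylor remainder of `G`.
  obtain ⟨ν, hν, hνlt⟩ : ∃ ν, μ N < ν ∧ ν < min ν' (min (μ (N + 1)) ((N + 2) * μ 0)) :=
    exists_between (lt_min hν' (lt_min (hS.strictMono (Nat.lt_succ_self N))
      (by linarith [hS.le_nsmul N])))
  rw [lt_min_iff, lt_min_iff] at hνlt
  obtain ⟨hνν', hνN, hν0⟩ := hνlt
  have hνpos : 0 < ν := (hS.pos N).trans hν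
  let V : ℝ → Vec n := fun t => WithLp.toLp 2 fun i => Y i t
  let F : Vec n → Vec n := fun x => ∑ l ∈ Finset.range (N + 1), H (l + 2) x
  have hV : ∀ᶠ t in atTop, HasDerivAt V (-(Matrix.toEuclideanLin A (V t)) + (F (V t) +
      ∑ k ∈ Finset.range (N + 1), (WithLp.toLp 2 fun i => s k i t : Vec n) +
      WithLp.toLp 2 fun i => r i t)) t := by
    filter_upwards [eventually_all.2 hYr] with t ht
    refine hasDerivAt_of_components fun i => (ht i).congr_deriv ?_
    simp [V, F, hHP, aeval_apply, Finset.sum_apply, Matrix.toLpLin_apply, Matrix.mulVec, dotProduct]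
  have hVlim : Tendsto V atTop (𝓝 0) := by
    have h1 := hS.isBigO_of_mem_tail (ν := μ 0 / 2) (by linarith) hY0
    refine h1.trans_tendsto (Real.tendsto_exp_atBot.comp ?_)
    exact (tendsto_iterLog (m + 1)).const_mul_atTop_of_neg (by linarith)
  have hF : (fun t => F (y t) - F (V t)) =o[atTop] fun t => y t - V t := by
    have h1 : HasStrictFDerivAt F (∑ _l ∈ Finset.range (N + 1), (0 : Vec n →L[ℝ] Vec n)) 0 :=
      HasStrictFDerivAt.fun_sum fun l _ =>
        hasStrictFDerivAt_of_isHomogeneousPolynomial (hH (l + 2) (by omega))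
    rw [Finset.sum_const_zero] at h1
    have h2 := h1.isLittleO.comp_tendsto (hylim.prodMk_nhds hVlim)
    simpa [Function.comp_def] using h2
  have hrem : (fun t => G (y t) - F (y t)) =O[atTop] logPow m (-ν) := by
    refine ((isBigO_sub_sum_homogeneous hG N).comp_tendsto hylim).trans ?_
    -- The rate `ν / (N + 2)` lies below `μ 0`, and its `(N + 2)`-nd power is exactly the required
    -- rate.
    have h1 := ((hy0 (ν / (N + 2)) (by
      rw [div_lt_iff₀ (by positivity)]; linarith)).norm_left.pow (N + 2))
    refine h1.trans_eventuallyEq (.of_forall fun t => ?_)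
    simp only [logPow_pow]
    congr 1
    push_cast
    field_simp
  have hfin : (fun t => y t - V t) =O[atTop] logPow m (-ν) := by
    refine isBigO_logPow_of_stable hA m ν hF
      (g₂ := fun t => (G (y t) - F (y t)) + (f t - ∑ k ∈ Finset.range (N + 1),
        (WithLp.toLp 2 fun i => s k i t : Vec n)) - WithLp.toLp 2 fun i => r i t)
      ((hrem.add (hfN.trans (logPow_isBigO (by linarith)))).sub
        (hS.isBigO_of_mem_tail hνN hr)) ?_
    filter_upwards [hy, hV] with t h1 h2
    refine (h1.sub h2).congr_deriv ?_
    rw [map_sub]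
    abel
  refine ⟨ν, hν, (hfin.trans_eventuallyEq (iterLog_rpow_eventuallyEq m (-ν)).symm).congr' ?_ .rfl⟩
  filter_upwards [(Finset.range (N + 1)).eventually_all.2 fun k _ => hqe k] with t ht
  rw [Finset.sum_congr rfl ht]
  congr 1
  ext i
  simp [V, hY, Finset.sum_apply]

end IterLogExpansion

theorem theorem10p13 (n : ℕ)
    (A : Matrix (Fin n) (Fin n) ℝ) (hA : RealExpansion.PositiveSpectrum A)
    (G : RealExpansion.Vec n → RealExpansion.Vec n) (hGlip : LocallyLipschitz G)
    (hGexp : RealExpansion.HasPolynomialExpansion G)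
    (f : ℝ → RealExpansion.Vec n) (hf : ∃ Tf : ℝ, 0 ≤ Tf ∧ ContinuousOn f (Set.Ici Tf))
    (y : ℝ → RealExpansion.Vec n)
    (hy : ∃ T₀ : ℝ, 0 ≤ T₀ ∧ RealExpansion.IsSolution A G f T₀ y)
    (hylim : Filter.Tendsto y Filter.atTop (nhds 0))
    (m : ℕ) (μ : ℕ → ℝ) (d : ℕ → ℕ)
    (hμpos : ∀ k, 0 < μ k) (hμmono : StrictMono μ)
    (hμlim : Filter.Tendsto μ Filter.atTop Filter.atTop)
    (hd : Monotone d) (hdm : ∀ k, m ≤ d k)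
    (hadd : RealExpansion.PreservesAddition (Set.range μ))
    (hunit : m = 0 → RealExpansion.PreservesUnitIncrement (Set.range μ))
    (phat : (k : ℕ) → (Fin (d k + 2) → ℝ) → RealExpansion.Vec n)
    (hphat : ∀ k, phat k ∈ RealExpansion.powTrigClass m (d k) n)
    (hfexp : RealExpansion.HasExpansion m μ d f phat) :
    ∃ qhat : (k : ℕ) → (Fin (d k + 2) → ℝ) → RealExpansion.Vec n,
      (∀ k, qhat k ∈ RealExpansion.powTrigClass m (d k) n) ∧
        RealExpansion.HasExpansion m μ d y qhat := by
  obtain ⟨T, -, -, hyd⟩ := hy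
  exact IterLogExpansion.exists_expansion ⟨hμpos, hμmono, hd, hdm, hadd, hunit⟩ hA hGexp
    ((eventually_gt_atTop T).mono hyd) hylim hphat hfexp
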